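/- Let $G$ be a finitely generated group with finitely generated subgroups $H_1,\dots,H_n$. For each $i$ let $X_i\subseteq G$ be a nontrivial $H_i$-almost invariant set: $H_iX_i=X_i$, the image $P$ of $X_i$ in $H_i\backslash G$ has finite symmetric difference with $Pa$ for every $a\in G$, and the images of $X_i$ and of its complement $X_i^*$ in $H_i\backslash G$ are both infinite. Let $E=\{gX_i,\,gX_i^*: g\in G,\ 1\le i\le n\}$. For $U,V\in E$, the corners of $(U,V)$ are $U\cap V$, $U\cap V^*$, $U^*\cap V$, $U^*\cap V^*$; a corner is small if it is contained in finitely many cosets $Hg$, where $H$ is a subgroup over which $U$ is nontrivially almost invariant. Suppose that the $X_i$ are in good position: if two corners of $U,V\in E$ are small, then one of their corners is empty. Write $U\le V$ if $U\cap V^*$ is empty or is the only small corner of $(U,V)$. An ultrafilter on $E$ with respect to an order is a subset $V\subseteq E$ which is upward closed and contains exactly one of $A,A^*$ for each $A\in E$. From an order on $E$ one builds a cube complex: its vertices are the ultrafilters, two of them are joined by an edge if they differ by replacing one element by its complement, and inductively for $m\ge2$ one $m$-cube is attached for each occurrence of the boundary of an $m$-cube in the $(m-1)$-skeleton. Let $K$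 and $\Lambda$ be the complexes obtained from $(E,\subset)$ and from $(E,\le)$. Let $C$ be the component of $K$ that contains the basic vertices $V_g=\{A\in E: g\in A\}$, $g\in G$. Fix a finite generating set of $G$, with Cayley graph $\Gamma$, balls $N_R(g)$ and coboundary operator $\delta$, and call $R>0$ admissible if $A\le B$ in $E$ and $N_R(g)\subseteq A$ imply $g\in B$. For $g\in G$ let $E_R$ be the set of all $A\in E$ such that $\delta A$ meets $N_R(g)$, let $U_g=\{A\in E\setminus E_R: g\in A\}$, and let $U_1$ be the union of $U_g$ and the set of all $B\in E_R$ with $A\le B$ for some $A\in U_g$. A basic vertex $W_g$ of $\Lambda$ is any set obtained from $U_1$ by repeating the following step until nothing is undecided: choose a minimal element $A$ among the undecided elements (those $B\in E$ with neither $B$ nor $B^*$ chosen so far) and add $A$ and all undecided $B$ with $A\le B$. Let $L$ be the component of $\Lambda$ that contains the basic vertices $W_g$. Then $\le$ is a partial order on $E$ that is reversed by complementation, and every ultrafilter for $\le$ is an ultrafilter for $\subset$. The $V_g$ are vertices of $K$ and lie in a single component $C$. An admissible $R$ exists, and for every admissible $R$: for each $g\in G$ at least one $W_g$ exists; every $W_g$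 is a vertex of $\Lambda$ and differs from $V_g$ in only finitely many elements; all the $W_g$ lie in a single component $L$; and there is a natural $G$-equivariant embedding $L\to C$, namely the topological embedding which is the inclusion on vertices and which maps each cube of $L$ isometrically onto the cube of $C$ with the same vertices. -/

import Mathlib

open scoped Pointwise symmDiff

namespace MinimalCubing

/-! ### Almost invariant sets -/

section AlmostInvariant

variable {G : Type*} [Group G]

/-- The set `H \ G` of cosets `H g`. -/
abbrev Cosets (H : Subgroup G) : Type _ := Quotient (QuotientGroup.rightRel H)

/-- The projection `g ↦ H g`. -/
def toCoset (H : Subgroup G) (g : G) : Cosets H := Quotient.mk _ g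

theorem toCoset_eq_iff {H : Subgroup G} {x y : G} :
    toCoset H x = toCoset H y ↔ y * x⁻¹ ∈ H := by
  unfold toCoset
  rw [Quotient.eq, QuotientGroup.rightRel_apply]

/-- The right action of `a : G` on `H \ G`, `H g ↦ H g a`. -/
def cosetMul (H : Subgroup G) (a : G) : Cosets H → Cosets H :=
  Quotient.lift (fun g => toCoset H (g * a)) (by
    intro x y hxy
    have h : y * x⁻¹ ∈ H := QuotientGroup.rightRel_apply.mp hxy
    rw [toCoset_eq_iff]
    simpa [mul_assoc] using h)

/-- `X` is an `H`-almost invariant subset of `G`: it is invariant under left multiplication by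
`H`, and its image `P` in `H \ G` is almost equal to `P a` for every `a` in `G`. -/
structure IsAlmostInvariant (H : Subgroup G) (X : Set G) : Prop where
  invariant : ∀ h ∈ H, ∀ x ∈ X, h * x ∈ X
  almost : ∀ a : G, ((cosetMul H a '' (toCoset H '' X)) ∆ (toCoset H '' X)).Finite

/-- `X` is a nontrivial `H`-almost invariant subset of `G`. -/
structure IsNontrivialAlmostInvariant (H : Subgroup G) (X : Set G) : Prop
    extends IsAlmostInvariant H X where
  infinite : (toCoset H '' X).Infinite
  compl_infinite : (toCoset H '' Xᶜ).Infinite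

/-- `W` is contained in a union of finitely many cosets `H g`. -/
def IsHFinite (H : Subgroup G) (W : Set G) : Prop :=
  ∃ F : Set G, F.Finite ∧ W ⊆ (H : Set G) * F

/-- For nontrivial almost invariant sets `U` and `V`: the set `U ∩ V` is small, that is,
`H`-finite where `U` is almost invariant over `H`.  (The choice of `H` does not matter, because
any two choices are commensurable.) -/
def IsSmallInter (U V : Set G) : Prop :=
  ∃ H : Subgroup G, IsNontrivialAlmostInvariant H U ∧ IsHFinite H (U ∩ V)

/-- `U` or its complement `U*`. -/
def side (U : Set G) : Bool → Set G
  | true => U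
  | false => Uᶜ

/-- The four corners `U ∩ V`, `U ∩ V*`, `U* ∩ V`, `U* ∩ V*` of the pair `(U, V)`. -/
def corner (U V : Set G) (p : Bool × Bool) : Set G := side U p.1 ∩ side V p.2

/-- The corner of `(U, V)` labelled by `p` is small. -/
def IsSmallCorner (U V : Set G) (p : Bool × Bool) : Prop :=
  IsSmallInter (side U p.1) (side V p.2)

/-- The set `E` of all translates of the `X i` and of their complements. -/
def translates {n : ℕ} (X : Fin n → Set G) : Set (Set G) :=
  {A | ∃ (i : Fin n) (g : G), A = g • X i ∨ A = g • (X i)ᶜ}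

/-- The family `X` is in good position: if two of the corners of `U, V ∈ E` are small, then one
of their corners is empty. -/
def GoodPosition {n : ℕ} (X : Fin n → Set G) : Prop :=
  ∀ U ∈ translates X, ∀ V ∈ translates X,
    (∃ p q : Bool × Bool, p ≠ q ∧ IsSmallCorner U V p ∧ IsSmallCorner U V q) →
      ∃ r : Bool × Bool, corner U V r = ∅

/-- Almost inclusion `U ≤ V`: the corner `U ∩ V*` is empty, or it is the only small one among the
four corners of `U` and `V`. -/
def AlmostLE (U V : Set G) : Prop :=
  corner U V (true, false) = ∅ ∨ ∀ p : Bool × Bool, IsSmallCorner U V p ↔ p = (true, false)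

/-! Translation invariance of these notions. -/

theorem side_smul (g : G) (U : Set G) (b : Bool) : side (g • U) b = g • side U b := by
  cases b
  · exact (Set.smul_set_compl).symm
  · rfl

theorem corner_smul (g : G) (U V : Set G) (p : Bool × Bool) :
    corner (g • U) (g • V) p = g • corner U V p := by
  simp only [corner, side_smul, Set.smul_set_inter]

theorem mem_conj_iff {H : Subgroup G} {g x : G} :
    x ∈ H.map (MulAut.conj g).toMonoidHom ↔ g⁻¹ * x * g ∈ H := by
  constructor
  · rintro ⟨h, hh, rfl⟩
    simpa [mul_assoc] using hh
  · intro h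
    exact ⟨_, h, by simp [mul_assoc]⟩

/-- The bijection from `H \ G` to `(g H g⁻¹) \ G` induced by left multiplication by `g`. -/
def cosetTranslate (H : Subgroup G) (g : G) :
    Cosets H → Cosets (H.map (MulAut.conj g).toMonoidHom) :=
  Quotient.lift (fun x => toCoset _ (g * x)) (by
    intro x y hxy
    have h : y * x⁻¹ ∈ H := QuotientGroup.rightRel_apply.mp hxy
    rw [toCoset_eq_iff, mem_conj_iff]
    simpa [mul_assoc] using h)

theorem cosetTranslate_injective (H : Subgroup G) (g : G) :
    Function.Injective (cosetTranslate H g) := by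
  intro a b
  induction a using Quotient.inductionOn with | _ x
  induction b using Quotient.inductionOn with | _ y
  intro h
  have h' : toCoset (H.map (MulAut.conj g).toMonoidHom) (g * x) = toCoset _ (g * y) := h
  rw [toCoset_eq_iff, mem_conj_iff] at h'
  refine toCoset_eq_iff.mpr ?_
  simpa [mul_assoc] using h'

theorem toCoset_image_smul (H : Subgroup G) (g : G) (X : Set G) :
    toCoset (H.map (MulAut.conj g).toMonoidHom) '' (g • X)
      = cosetTranslate H g '' (toCoset H '' X) := by
  rw [← Set.image_smul, Set.image_image, Set.image_image]
  rfl

theorem cosetMul_image_translate (H : Subgroup G) (g a : G) (P : Set (Cosets H)) :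
    cosetMul (H.map (MulAut.conj g).toMonoidHom) a '' (cosetTranslate H g '' P)
      = cosetTranslate H g '' (cosetMul H a '' P) := by
  rw [Set.image_image, Set.image_image]
  refine Set.image_congr' fun c => ?_
  induction c using Quotient.inductionOn with | _ x
  change toCoset _ (g * x * a) = toCoset _ (g * (x * a))
  rw [mul_assoc]

theorem IsNontrivialAlmostInvariant.smul {H : Subgroup G} {X : Set G}
    (h : IsNontrivialAlmostInvariant H X) (g : G) :
    IsNontrivialAlmostInvariant (H.map (MulAut.conj g).toMonoidHom) (g • X) where
  invariant := by
    rintro _ ⟨k, hk, rfl⟩ _ ⟨x, hx, rfl⟩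
    exact ⟨k * x, h.invariant k hk x hx, by simp [mul_assoc]⟩
  almost a := by
    rw [toCoset_image_smul, cosetMul_image_translate,
      ← Set.image_symmDiff (cosetTranslate_injective H g)]
    exact (h.almost a).image _
  infinite := by
    rw [toCoset_image_smul]
    exact h.infinite.image (cosetTranslate_injective H g).injOn
  compl_infinite := by
    rw [← Set.smul_set_compl, toCoset_image_smul]
    exact h.compl_infinite.image (cosetTranslate_injective H g).injOn

theorem IsSmallInter.smul {U V : Set G} (h : IsSmallInter U V) (g : G) :
    IsSmallInter (g • U) (g • V) := by
  obtain ⟨H, hU, F, hF, hsub⟩ := h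
  refine ⟨_, hU.smul g, g • F, hF.smul_set, ?_⟩
  rw [← Set.smul_set_inter]
  rintro _ ⟨x, hx, rfl⟩
  obtain ⟨k, hk, f, hf, rfl⟩ := hsub hx
  exact ⟨g * k * g⁻¹, ⟨k, hk, by simp⟩, g * f, ⟨f, hf, rfl⟩, by simp [mul_assoc]⟩

theorem isSmallCorner_smul_iff (g : G) (U V : Set G) (p : Bool × Bool) :
    IsSmallCorner (g • U) (g • V) p ↔ IsSmallCorner U V p := by
  simp only [IsSmallCorner, side_smul]
  constructor
  · intro h
    simpa using h.smul g⁻¹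
  · intro h
    exact h.smul g

theorem almostLE_smul_iff (g : G) (U V : Set G) :
    AlmostLE (g • U) (g • V) ↔ AlmostLE U V := by
  simp only [AlmostLE, isSmallCorner_smul_iff, corner_smul, Set.smul_set_eq_empty]

theorem smul_mem_translates {n : ℕ} {X : Fin n → Set G} (g : G) {A : Set G}
    (hA : A ∈ translates X) : g • A ∈ translates X := by
  obtain ⟨i, k, rfl | rfl⟩ := hA
  · exact ⟨i, g * k, Or.inl (smul_smul _ _ _)⟩
  · exact ⟨i, g * k, Or.inr (smul_smul _ _ _)⟩

theorem smul_mem_translates_iff {n : ℕ} {X : Fin n → Set G} (g : G) {A : Set G} :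
    g • A ∈ translates X ↔ A ∈ translates X :=
  ⟨fun h => by simpa using smul_mem_translates g⁻¹ h, smul_mem_translates g⟩

end AlmostInvariant

/-! ### The cube complex obtained from a graph by filling in all cubes -/

section CubeComplex

universe u v w

/-- `φ` is the vertex map of an `n`-cube of the cube complex with `1`-skeleton `Γ` that is
constructed inductively as follows: the `0`- and `1`-cubes are the vertices and the edges of `Γ`,
and for `n ≥ 2` an `n`-cube is attached for each occurrence of the boundary of an `n`-cube in
the `(n-1)`-skeleton. -/
def IsCube {V : Type u} (Γ : SimpleGraph V) : (n : ℕ) → ((Fin n → Bool) → V) → Prop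
  | 0, _ => True
  | 1, φ => Γ.Adj (φ fun _ => false) (φ fun _ => true)
  | n + 2, φ => Function.Injective φ ∧
      ∀ (i : Fin (n + 2)) (b : Bool), IsCube Γ (n + 1) fun x => φ (i.insertNth b x)

/-- The parametrised cubes of the complex. -/
def Cell {V : Type u} (Γ : SimpleGraph V) : Type u :=
  Σ n : ℕ, {φ : (Fin n → Bool) → V // IsCube Γ n φ}

/-- The isometry of `{0,1}^m` onto the vertex set of a face of `[0,1]^n` given by an injection
`e` of the coordinates and by `c`: the coordinate `e i` is `x i`, reflected if `c (e i) = 1`, and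
a coordinate `j` outside the range of `e` is constantly `c j`. -/
noncomputable def faceVertex {m n : ℕ} (e : Fin m ↪ Fin n) (c : Fin n → Bool) (x : Fin m → Bool) :
    Fin n → Bool :=
  fun j => xor (c j) (Function.extend e x (fun _ => false) j)

/-- The isometry of `[0,1]^m` onto a face of `[0,1]^n` which extends `faceVertex e c`. -/
noncomputable def facePoint {m n : ℕ} (e : Fin m ↪ Fin n) (c : Fin n → Bool)
    (x : Fin m → unitInterval) : Fin n → unitInterval :=
  fun j => if c j then unitInterval.symm (Function.extend e x (fun _ => 0) j)
    else Function.extend e x (fun _ => 0) j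

/-- The disjoint union of standard cubes `[0,1]^n`, one for each parametrised cube. -/
abbrev CubePoint {V : Type u} (Γ : SimpleGraph V) : Type u :=
  Σ σ : Cell Γ, (Fin σ.1 → unitInterval)

/-- The gluing: if the parametrised cube `ψ` is the face of the parametrised cube `φ` given by
`e` and `c`, then each point of `ψ` is glued to the corresponding point of `φ`.  With `m = n`,
this identifies the different parametrisations of the same cube. -/
inductive Glue {V : Type u} (Γ : SimpleGraph V) : CubePoint Γ → CubePoint Γ → Prop
  | face {m n : ℕ} (ψ : {ψ : (Fin m → Bool) → V // IsCube Γ m ψ})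
      (φ : {φ : (Fin n → Bool) → V // IsCube Γ n φ}) (e : Fin m ↪ Fin n) (c : Fin n → Bool)
      (h : ∀ y, ψ.1 y = φ.1 (faceVertex e c y)) (x : Fin m → unitInterval) :
      Glue Γ ⟨⟨m, ψ⟩, x⟩ ⟨⟨n, φ⟩, facePoint e c x⟩

/-- The cube complex with `1`-skeleton `Γ`, as a topological space (with the quotient topology
of the disjoint union of its cubes). -/
def Realization {V : Type u} (Γ : SimpleGraph V) : Type u := Quot (Glue Γ)

instance {V : Type u} (Γ : SimpleGraph V) : TopologicalSpace (Realization Γ) :=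
  inferInstanceAs (TopologicalSpace (Quot (Glue Γ)))

theorem IsCube.map {V : Type u} {V' : Type v} {Γ : SimpleGraph V} {Γ' : SimpleGraph V'}
    (f : Γ.Copy Γ') : ∀ {n : ℕ} {φ : (Fin n → Bool) → V}, IsCube Γ n φ →
      IsCube Γ' n (fun y => f (φ y))
  | 0, _, _ => trivial
  | 1, _, h => f.toHom.map_adj h
  | _ + 2, _, h => ⟨f.injective.comp h.1, fun i b => IsCube.map f (h.2 i b)⟩

/-- The image of a parametrised cube under an injective graph homomorphism. -/
def Cell.map {V : Type u} {V' : Type v} {Γ : SimpleGraph V} {Γ' : SimpleGraph V'}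
    (f : Γ.Copy Γ') (σ : Cell Γ) : Cell Γ' :=
  ⟨σ.1, fun y => f (σ.2.1 y), σ.2.2.map f⟩

/-- The map of cube complexes induced by an injective graph homomorphism `f`: it maps the cube
`φ` by the identity of `[0,1]^n` onto the cube `f ∘ φ`. -/
def Realization.map {V : Type u} {V' : Type v} {Γ : SimpleGraph V} {Γ' : SimpleGraph V'}
    (f : Γ.Copy Γ') : Realization Γ → Realization Γ' :=
  Quot.map (fun p => ⟨p.1.map f, p.2⟩) (by
    rintro _ _ ⟨ψ, φ, e, c, h, x⟩
    exact Glue.face (m := _) (n := _) ⟨fun y => f (ψ.1 y), ψ.2.map f⟩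
      ⟨fun y => f (φ.1 y), φ.2.map f⟩ e c (fun y => congrArg f (h y)) x)

theorem Realization.map_id {V : Type u} {Γ : SimpleGraph V} (f : Γ.Copy Γ)
    (hf : ∀ v, f v = v) (x : Realization Γ) : Realization.map f x = x := by
  obtain rfl : f = SimpleGraph.Copy.id Γ := SimpleGraph.Copy.ext hf
  induction x using Quot.inductionOn with | _ p
  rfl

theorem Realization.map_map {V : Type u} {V' : Type v} {V'' : Type w} {Γ : SimpleGraph V}
    {Γ' : SimpleGraph V'} {Γ'' : SimpleGraph V''} (f : Γ.Copy Γ') (f' : Γ'.Copy Γ'')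
    (k : Γ.Copy Γ'') (hk : ∀ v, k v = f' (f v)) (x : Realization Γ) :
    Realization.map f' (Realization.map f x) = Realization.map k x := by
  obtain rfl : k = f'.comp f := SimpleGraph.Copy.ext hk
  induction x using Quot.inductionOn with | _ p
  rfl

end CubeComplex

/-! ### Ultrafilters and the associated cube complexes -/

section Cubing

variable {G : Type*} [Group G]

/-- `V` is an ultrafilter on the set `E` of subsets of `G` (closed under complementation) with
respect to the partial order `r` and the involution `A ↦ A*`. -/
structure IsUltrafilterOn (E : Set (Set G)) (r : Set G → Set G → Prop) (V : Set (Set G)) :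
    Prop where
  subset : V ⊆ E
  mem_xor : ∀ A ∈ E, (A ∈ V ∨ Aᶜ ∈ V) ∧ ¬ (A ∈ V ∧ Aᶜ ∈ V)
  upward : ∀ A ∈ V, ∀ B ∈ E, r A B → B ∈ V

/-- The data for the construction: a `G`-invariant set `E` of subsets of `G`, a `G`-invariant
relation on it, and a `G`-invariant collection of basic vertices. -/
structure CubingData (G : Type*) [Group G] where
  E : Set (Set G)
  rel : Set G → Set G → Prop
  basic : Set (Set (Set G))
  smul_mem : ∀ (g : G) (A : Set G), A ∈ E → g • A ∈ E
  rel_smul : ∀ (g : G) (A B : Set G), rel A B → rel (g • A) (g • B)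
  basic_smul : ∀ (g : G) (V : Set (Set G)), V ∈ basic → g • V ∈ basic

theorem IsUltrafilterOn.smul {D : CubingData G} {V : Set (Set G)}
    (h : IsUltrafilterOn D.E D.rel V) (g : G) : IsUltrafilterOn D.E D.rel (g • V) where
  subset := by
    rintro _ ⟨A, hA, rfl⟩
    exact D.smul_mem g A (h.subset hA)
  mem_xor A hA := by
    have := h.mem_xor (g⁻¹ • A) (D.smul_mem _ _ hA)
    rwa [Set.mem_smul_set_iff_inv_smul_mem, Set.mem_smul_set_iff_inv_smul_mem,
      Set.smul_set_compl]
  upward A hA B hB hAB := by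
    rw [Set.mem_smul_set_iff_inv_smul_mem] at hA ⊢
    exact h.upward _ hA _ (D.smul_mem _ _ hB) (D.rel_smul _ _ _ hAB)

/-- The vertices of the whole complex: all ultrafilters. -/
abbrev CubingData.Ultra (D : CubingData G) : Type _ :=
  {V : Set (Set G) // IsUltrafilterOn D.E D.rel V}

/-- The `1`-skeleton of the whole complex: two ultrafilters are joined by an edge if they differ
by replacing one element by its complement. -/
def CubingData.fullGraph (D : CubingData G) : SimpleGraph D.Ultra where
  Adj V V' := ∃ A ∈ V.1, V'.1 = (V.1 \ {A}) ∪ {Aᶜ}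
  symm := ⟨by
    rintro ⟨V, hV⟩ ⟨V', hV'⟩ ⟨A, hA, h⟩
    simp only at hA h
    have hc : Aᶜ ∉ V := fun hc => (hV.mem_xor A (hV.subset hA)).2 ⟨hA, hc⟩
    refine ⟨Aᶜ, by simp [h], ?_⟩
    simp only [h, compl_compl]
    ext B
    simp only [Set.mem_union, Set.mem_sdiff, Set.mem_singleton_iff]
    constructor
    · intro hB
      by_cases hBA : B = A
      · exact Or.inr hBA
      · exact Or.inl ⟨Or.inl ⟨hB, hBA⟩, fun h' => hc (h' ▸ hB)⟩
    · rintro (⟨⟨hB, _⟩ | hB, hB'⟩ | rfl)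
      · exact hB
      · exact absurd hB hB'
      · exact hA⟩
  loopless := ⟨by
    rintro ⟨V, hV⟩ ⟨A, hA, h⟩
    simp only at hA h
    have hc : Aᶜ ∈ V := by rw [h]; simp
    exact (hV.mem_xor A (hV.subset hA)).2 ⟨hA, hc⟩⟩

/-- The action of `g` on the ultrafilters. -/
def CubingData.actUltra (D : CubingData G) (g : G) (V : D.Ultra) : D.Ultra :=
  ⟨g • V.1, V.2.smul g⟩

theorem CubingData.actUltra_adj (D : CubingData G) (g : G) {V V' : D.Ultra}
    (h : D.fullGraph.Adj V V') : D.fullGraph.Adj (D.actUltra g V) (D.actUltra g V') := by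
  obtain ⟨A, hA, h⟩ := h
  refine ⟨g • A, Set.smul_mem_smul_set hA, ?_⟩
  change g • V'.1 = (g • V.1 \ {g • A}) ∪ {(g • A)ᶜ}
  rw [h, Set.smul_set_union, Set.smul_set_sdiff, Set.smul_set_singleton, Set.smul_set_singleton,
    Set.smul_set_compl]

/-- The vertices of the part of the complex that is connected to the basic vertices. -/
abbrev CubingData.Vertex (D : CubingData G) : Type _ :=
  {V : D.Ultra // ∃ W : D.Ultra, W.1 ∈ D.basic ∧ D.fullGraph.Reachable W V}

/-- The `1`-skeleton of the part of the complex that is connected to the basic vertices. -/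
def CubingData.graph (D : CubingData G) : SimpleGraph D.Vertex :=
  D.fullGraph.comap Subtype.val

/-- The action of `g` on the `1`-skeleton. -/
def CubingData.act (D : CubingData G) (g : G) : D.graph.Copy D.graph :=
  SimpleGraph.Hom.toCopy
    { toFun := fun V => ⟨D.actUltra g V.1, by
        obtain ⟨W, hW, hr⟩ := V.2
        refine ⟨D.actUltra g W, D.basic_smul g _ hW, ?_⟩
        exact hr.map (⟨D.actUltra g, fun h => D.actUltra_adj g h⟩ : D.fullGraph →g D.fullGraph)⟩
      map_rel' := fun h => D.actUltra_adj g h }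
    (by
      intro V V' h
      have h' : g • V.1.1 = g • V'.1.1 := congrArg (fun U : D.Vertex => U.1.1) h
      exact Subtype.ext (Subtype.ext (smul_left_cancel g h')))

/-- The cube complex spanned by the vertices that are connected to the basic vertices. -/
def CubingData.Complex (D : CubingData G) : Type _ := Realization D.graph

instance (D : CubingData G) : TopologicalSpace D.Complex :=
  inferInstanceAs (TopologicalSpace (Realization D.graph))

/-- The action of `G` on the cube complex. -/
instance (D : CubingData G) : MulAction G D.Complex where
  smul g x := Realization.map (D.act g) x
  one_smul x := Realization.map_id (D.act 1)
    (fun V => Subtype.ext (Subtype.ext (one_smul G V.1.1))) x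
  mul_smul g k x := (Realization.map_map (D.act k) (D.act g) (D.act (g * k))
    (fun V => Subtype.ext (Subtype.ext (mul_smul g k V.1.1))) x).symm

/-! ### The cubing for inclusion -/

/-- The basic vertex `V_g`, the set of all elements of `E` that contain `g`. -/
def basicV (E : Set (Set G)) (g : G) : Set (Set G) := {A ∈ E | g ∈ A}

/-- The data of the cubing `C`, constructed from `E` with inclusion. -/
def cubingC {n : ℕ} (X : Fin n → Set G) : CubingData G where
  E := translates X
  rel := fun A B => A ⊆ B
  basic := Set.range (basicV (translates X))
  smul_mem := fun g _ hA => smul_mem_translates g hA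
  rel_smul := fun _ _ _ h => Set.smul_set_mono h
  basic_smul := by
    rintro g _ ⟨k, rfl⟩
    refine ⟨g * k, ?_⟩
    ext A
    rw [Set.mem_smul_set_iff_inv_smul_mem]
    simp only [basicV, Set.mem_ofPred_eq, smul_mem_translates_iff,
      Set.mem_smul_set_iff_inv_smul_mem, inv_inv, smul_eq_mul]

/-! ### The cubing for almost inclusion -/

/-- The ball `N_R(g)` (its set of vertices) in the Cayley graph with respect to `S`. -/
def ball (S : Set G) (R : ℕ) (g : G) : Set G := {h | (SimpleGraph.mulCayley S).edist g h ≤ R}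

/-- The coboundary `δA`: the edges of the Cayley graph that join `A` to its complement. -/
def coboundary (S : Set G) (A : Set G) : Set (Sym2 G) :=
  {e | ∃ a ∈ A, ∃ b ∈ Aᶜ, (SimpleGraph.mulCayley S).Adj a b ∧ e = s(a, b)}

/-- The radius `R` is large enough for the construction of basic vertices: if `A ≤ B` in `E`, and
`N_R(g) ⊆ A`, then `g ∈ B`. -/
def IsAdmissibleRadius {n : ℕ} (X : Fin n → Set G) (S : Set G) (R : ℕ) : Prop :=
  0 < R ∧ ∀ A ∈ translates X, ∀ B ∈ translates X, AlmostLE A B →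
    ∀ g ∈ A, ball S R g ⊆ A → g ∈ B

/-- The set `E_R` of the elements of `E` whose coboundary meets the ball `N_R(g)`. -/
def nearSets {n : ℕ} (X : Fin n → Set G) (S : Set G) (R : ℕ) (g : G) : Set (Set G) :=
  {A ∈ translates X | ∃ e ∈ coboundary S A, ∃ v ∈ ball S R g, v ∈ e}

/-- The set `U_g` of the elements of `E - E_R` that contain `g`. -/
def initialU {n : ℕ} (X : Fin n → Set G) (S : Set G) (R : ℕ) (g : G) : Set (Set G) :=
  {A ∈ translates X \ nearSets X S R g | g ∈ A}

/-- The set `U_1`, obtained from `U_g` by adding the elements of `E_R` above an element of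
`U_g`. -/
def firstU {n : ℕ} (X : Fin n → Set G) (S : Set G) (R : ℕ) (g : G) : Set (Set G) :=
  initialU X S R g ∪ {B ∈ nearSets X S R g | ∃ A ∈ initialU X S R g, AlmostLE A B}

/-- The set `E - (U ∪ U*)` of the elements of `E` not yet decided by `U`. -/
def undecided (E U : Set (Set G)) : Set (Set G) := {A ∈ E | A ∉ U ∧ Aᶜ ∉ U}

/-- One step of the completion: choose a minimal undecided `A` and add it, together with all
undecided elements above `A`. -/
def CompletionStep (E : Set (Set G)) (r : Set G → Set G → Prop) (U U' : Set (Set G)) : Prop :=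
  ∃ A ∈ undecided E U, (∀ B ∈ undecided E U, r B A → B = A) ∧
    U' = U ∪ {A} ∪ {B ∈ undecided E U | r A B}

/-- `W` is a basic vertex `W_g` for almost inclusion: it is obtained from `U_1` by finitely many
completion steps, after which nothing is undecided. -/
def IsBasicW {n : ℕ} (X : Fin n → Set G) (S : Set G) (R : ℕ) (g : G) (W : Set (Set G)) : Prop :=
  Relation.ReflTransGen (CompletionStep (translates X) AlmostLE) (firstU X S R g) W ∧
    undecided (translates X) W = ∅

theorem mulCayley_adj_smul (S : Set G) (g : G) {a b : G}
    (h : (SimpleGraph.mulCayley S).Adj a b) :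
    (SimpleGraph.mulCayley S).Adj (g * a) (g * b) := by
  rw [SimpleGraph.mulCayley_adj'] at h ⊢
  obtain ⟨hne, s, hs, h⟩ := h
  refine ⟨fun h' => hne (mul_left_cancel h'), s, hs, ?_⟩
  rcases h with h | h
  · exact Or.inl (by rw [mul_assoc, h])
  · exact Or.inr (by rw [mul_assoc, ← h])

theorem edist_smul_le (S : Set G) (g a b : G) :
    (SimpleGraph.mulCayley S).edist (g * a) (g * b) ≤ (SimpleGraph.mulCayley S).edist a b := by
  rw [SimpleGraph.edist_eq_sInf (u := a)]
  refine le_sInf ?_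
  rintro _ ⟨p, rfl⟩
  let f : SimpleGraph.mulCayley S →g SimpleGraph.mulCayley S :=
    ⟨fun x => g * x, fun h => mulCayley_adj_smul S g h⟩
  have := SimpleGraph.edist_le (p.map f)
  rw [SimpleGraph.Walk.length_map] at this
  exact this

theorem mem_ball_smul (S : Set G) (R : ℕ) (k g h : G) (hh : h ∈ ball S R g) :
    k * h ∈ ball S R (k * g) :=
  (edist_smul_le S k g h).trans hh

theorem smul_mem_nearSets {n : ℕ} {X : Fin n → Set G} {S : Set G} {R : ℕ} {g : G} (k : G)
    {A : Set G} (hA : A ∈ nearSets X S R g) : k • A ∈ nearSets X S R (k * g) := by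
  obtain ⟨hE, e, ⟨a, ha, b, hb, hab, rfl⟩, v, hv, hve⟩ := hA
  refine ⟨smul_mem_translates k hE, s(k * a, k * b),
    ⟨k * a, Set.smul_mem_smul_set ha, k * b, ?_, mulCayley_adj_smul S k hab, rfl⟩,
    k * v, mem_ball_smul S R k g v hv, ?_⟩
  · rw [← Set.smul_set_compl]
    exact Set.smul_mem_smul_set hb
  · rw [Sym2.mem_iff] at hve ⊢
    rcases hve with rfl | rfl
    · exact Or.inl rfl
    · exact Or.inr rfl

theorem smul_mem_nearSets_iff {n : ℕ} {X : Fin n → Set G} {S : Set G} {R : ℕ} {g : G} (k : G)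
    {A : Set G} : k • A ∈ nearSets X S R (k * g) ↔ A ∈ nearSets X S R g :=
  ⟨fun h => by simpa using smul_mem_nearSets k⁻¹ h, smul_mem_nearSets k⟩

theorem smul_mem_initialU_iff {n : ℕ} {X : Fin n → Set G} {S : Set G} {R : ℕ} {g : G} (k : G)
    {A : Set G} : k • A ∈ initialU X S R (k * g) ↔ A ∈ initialU X S R g := by
  simp only [initialU, Set.mem_ofPred_eq, Set.mem_sdiff, smul_mem_translates_iff,
    smul_mem_nearSets_iff, Set.mem_smul_set_iff_inv_smul_mem, smul_eq_mul, inv_mul_cancel_left]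

theorem smul_firstU {n : ℕ} (X : Fin n → Set G) (S : Set G) (R : ℕ) (g k : G) :
    k • firstU X S R g = firstU X S R (k * g) := by
  ext B
  obtain ⟨B, rfl⟩ : ∃ B', B = k • B' := ⟨k⁻¹ • B, by simp⟩
  rw [Set.smul_mem_smul_set_iff]
  simp only [firstU, Set.mem_union, Set.mem_ofPred_eq, smul_mem_initialU_iff,
    smul_mem_nearSets_iff]
  refine or_congr Iff.rfl (and_congr Iff.rfl ⟨?_, ?_⟩)
  · rintro ⟨A, hA, h⟩
    exact ⟨k • A, (smul_mem_initialU_iff k).mpr hA, (almostLE_smul_iff k A B).mpr h⟩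
  · rintro ⟨A, hA, h⟩
    obtain ⟨A, rfl⟩ : ∃ A', A = k • A' := ⟨k⁻¹ • A, by simp⟩
    exact ⟨A, (smul_mem_initialU_iff k).mp hA, (almostLE_smul_iff k A B).mp h⟩

theorem smul_undecided {n : ℕ} (X : Fin n → Set G) (U : Set (Set G)) (k : G) :
    undecided (translates X) (k • U) = k • undecided (translates X) U := by
  ext B
  obtain ⟨B, rfl⟩ : ∃ B', B = k • B' := ⟨k⁻¹ • B, by simp⟩
  simp only [undecided, Set.smul_mem_smul_set_iff, Set.mem_ofPred_eq, smul_mem_translates_iff,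
    ← Set.smul_set_compl]

theorem CompletionStep.smul {n : ℕ} {X : Fin n → Set G} {U U' : Set (Set G)}
    (h : CompletionStep (translates X) AlmostLE U U') (k : G) :
    CompletionStep (translates X) AlmostLE (k • U) (k • U') := by
  obtain ⟨A, hA, hmin, rfl⟩ := h
  refine ⟨k • A, ?_, ?_, ?_⟩
  · rw [smul_undecided]
    exact Set.smul_mem_smul_set hA
  · rw [smul_undecided]
    rintro _ ⟨B, hB, rfl⟩ hBA
    exact congrArg _ (hmin B hB ((almostLE_smul_iff k B A).mp hBA))
  · rw [Set.smul_set_union, Set.smul_set_union, Set.smul_set_singleton, smul_undecided]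
    congr 1
    ext B
    obtain ⟨B, rfl⟩ : ∃ B', B = k • B' := ⟨k⁻¹ • B, by simp⟩
    simp only [Set.smul_mem_smul_set_iff, Set.mem_ofPred_eq, almostLE_smul_iff]

theorem IsBasicW.smul {n : ℕ} {X : Fin n → Set G} {S : Set G} {R : ℕ} {g : G}
    {W : Set (Set G)} (h : IsBasicW X S R g W) (k : G) :
    IsBasicW X S R (k * g) (k • W) := by
  refine ⟨?_, ?_⟩
  · rw [← smul_firstU]
    have h1 := h.1
    clear h
    induction h1 with
    | refl => exact Relation.ReflTransGen.refl
    | tail _ hs ih => exact ih.tail (hs.smul k)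
  · rw [smul_undecided, h.2, Set.smul_set_empty]

/-- The data of the cubing `L`, constructed from `E` with almost inclusion. -/
def cubingL {n : ℕ} (X : Fin n → Set G) (S : Set G) (R : ℕ) : CubingData G where
  E := translates X
  rel := AlmostLE
  basic := {W | ∃ g : G, IsBasicW X S R g W}
  smul_mem := fun g _ hA => smul_mem_translates g hA
  rel_smul := fun g A B h => (almostLE_smul_iff g A B).mpr h
  basic_smul := by
    rintro g W ⟨k, hW⟩
    exact ⟨g * k, hW.smul g⟩

end Cubing

end MinimalCubing

namespace MinimalCubing

/-! ### Finiteness modulo a subgroup -/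

section HFinite

variable {G : Type*} [Group G]

/-! Almost inclusion is an order because smallness of `U ∩ V` does not depend on whether cosets of
the subgroup of `U` or of `V` are counted (`isHFinite_inter_iff`). Hence the relation "`U ∩ Vᶜ` is
small" is reversed by complementation and transitive. It fails to be antisymmetric only when `Uᶜ ∩
V` is small as well, and for such pairs `AlmostLE` requires genuine inclusion. Since inclusion
implies almost inclusion, fewer sets are upward closed for the latter, so its ultrafilters are among
those for inclusion.

Connectedness comes from local finiteness: only finitely many elements of `E` separate two given
points, or have coboundary meeting a given ball (`finite_separating`, `finite_nearSets`). For both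
orders, ultrafilters with finite difference are joined by a path that flips minimal elements of the
difference (`CubingData.IsPocset.reachable`). Outside the finite set `E_R` a basic vertex `W_g`
agrees with `V_g`, so the `W_g` lie in one component, and its vertices lie in `C`.

For a single pair `A ≤ B` a suitable radius exists because `A ∩ Bᶜ` is covered by finitely many
cosets. A uniform radius exists because the `H i` are finitely generated: up to translation, for all
but finitely many pairs the boundary of `A` lies on one side of `B` (`exists_finite_pairs`). If this
holds in both orders, some corner is empty, and almost inclusion is inclusion.

For the embedding, a point of a target cube is in the image exactly when it lies in a face that
lifts. This criterion survives gluing, because two faces of a cube that share a point meet in a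
common face (`exists_common_face`). It gives injectivity, and closedness of the map since cubes are
compact with finitely many faces. Equivariance is checked on vertices. -/

theorem isHFinite_iff_finite_image {H : Subgroup G} {W : Set G} :
    IsHFinite H W ↔ (toCoset H '' W).Finite := by
  constructor
  · rintro ⟨F, hF, hW⟩
    refine (hF.image (toCoset H)).subset ?_
    rintro _ ⟨x, hx, rfl⟩
    obtain ⟨h, hh, f, hf, rfl⟩ := hW hx
    refine ⟨f, hf, toCoset_eq_iff.mpr ?_⟩
    simpa using hh
  · intro h
    refine ⟨Quotient.out '' (toCoset H '' W), h.image _, fun x hx => ?_⟩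
    have hq : toCoset H (toCoset H x).out = toCoset H x := Quotient.out_eq _
    rw [toCoset_eq_iff] at hq
    exact ⟨_, hq, _, ⟨_, ⟨x, hx, rfl⟩, rfl⟩, by simp⟩

theorem isHFinite_empty (H : Subgroup G) : IsHFinite H (∅ : Set G) :=
  ⟨∅, Set.finite_empty, Set.empty_subset _⟩

theorem IsHFinite.mono {H : Subgroup G} {W W' : Set G} (h : IsHFinite H W) (hW : W' ⊆ W) :
    IsHFinite H W' := by
  obtain ⟨F, hF, hs⟩ := h
  exact ⟨F, hF, hW.trans hs⟩

theorem IsHFinite.union {H : Subgroup G} {W W' : Set G} (h : IsHFinite H W)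
    (h' : IsHFinite H W') : IsHFinite H (W ∪ W') := by
  rw [isHFinite_iff_finite_image] at *
  rw [Set.image_union]
  exact h.union h'

theorem IsHFinite.biUnion {H : Subgroup G} {ι : Type*} {s : Set ι} (hs : s.Finite)
    {W : ι → Set G} (h : ∀ i ∈ s, IsHFinite H (W i)) : IsHFinite H (⋃ i ∈ s, W i) := by
  rw [isHFinite_iff_finite_image, Set.image_iUnion₂]
  exact hs.biUnion fun i hi => isHFinite_iff_finite_image.mp (h i hi)

theorem IsAlmostInvariant.mul_mem_iff {H : Subgroup G} {X : Set G} (hX : IsAlmostInvariant H X)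
    {h : G} (hh : h ∈ H) {x : G} : h * x ∈ X ↔ x ∈ X :=
  ⟨fun hx => by simpa using hX.invariant h⁻¹ (H.inv_mem hh) _ hx, hX.invariant h hh x⟩

/-- If `H x = H y b⁻¹` with `y ∈ X`, then `x * b ∈ H y ⊆ X`. So the cosets of these points lie in
`P` but not in `P b⁻¹`. -/
theorem IsAlmostInvariant.isHFinite_mul_notMem {H : Subgroup G} {X : Set G}
    (hX : IsAlmostInvariant H X) (b : G) : IsHFinite H {x ∈ X | x * b ∉ X} := by
  rw [isHFinite_iff_finite_image]
  refine (hX.almost b⁻¹).subset ?_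
  rintro _ ⟨x, ⟨hx, hxb⟩, rfl⟩
  refine Or.inr ⟨⟨x, hx, rfl⟩, ?_⟩
  rintro ⟨_, ⟨y, hy, rfl⟩, hyx⟩
  have hyx' : toCoset H (y * b⁻¹) = toCoset H x := hyx
  rw [toCoset_eq_iff] at hyx'
  refine hxb ?_
  have := hX.invariant _ hyx' y hy
  simpa [mul_assoc] using this

theorem cosetMul_bijective (H : Subgroup G) (a : G) : Function.Bijective (cosetMul H a) := by
  refine Function.bijective_iff_has_inverse.mpr ⟨cosetMul H a⁻¹, fun c => ?_, fun c => ?_⟩ <;>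
  · induction c using Quotient.inductionOn with | _ x
    refine congrArg (toCoset H) ?_
    simp [mul_assoc]

theorem IsAlmostInvariant.image_compl {H : Subgroup G} {X : Set G}
    (hX : IsAlmostInvariant H X) : toCoset H '' Xᶜ = (toCoset H '' X)ᶜ := by
  ext c
  induction c using Quotient.inductionOn with | _ x
  constructor
  · rintro ⟨y, hy, hyx⟩ ⟨z, hz, hzx⟩
    have : toCoset H z = toCoset H y := hzx.trans hyx.symm
    rw [toCoset_eq_iff] at this
    exact hy (by simpa using hX.invariant _ this z hz)
  · exact fun h => ⟨x, fun hx => h ⟨x, hx, rfl⟩, rfl⟩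

theorem IsNontrivialAlmostInvariant.compl {H : Subgroup G} {X : Set G}
    (hX : IsNontrivialAlmostInvariant H X) : IsNontrivialAlmostInvariant H Xᶜ where
  invariant := fun _ hh _ hx h => hx ((hX.mul_mem_iff hh).mp h)
  almost a := by
    rw [hX.image_compl, Set.image_compl_eq (cosetMul_bijective H a), compl_symmDiff_compl]
    exact hX.almost a
  infinite := hX.compl_infinite
  compl_infinite := by
    rw [compl_compl]
    exact hX.infinite

theorem IsNontrivialAlmostInvariant.not_isHFinite {H : Subgroup G} {X : Set G}
    (hX : IsNontrivialAlmostInvariant H X) : ¬ IsHFinite H X :=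
  fun h => hX.infinite (isHFinite_iff_finite_image.mp h)

/-- An `H`-finite subset `W` of a `K`-almost invariant set `U` is `K`-finite, as soon as `U` has
`H`-finite intersection with some `H`-invariant set which is not itself `H`-finite. -/
theorem IsAlmostInvariant.isHFinite_of_isHFinite {H K : Subgroup G} {U Z W : Set G}
    (hU : IsAlmostInvariant K U) (hZ : ∀ h ∈ H, ∀ z ∈ Z, h * z ∈ Z) (hZ' : ¬ IsHFinite H Z)
    (hWU : W ⊆ U) (hW : IsHFinite H W) (hUZ : IsHFinite H (U ∩ Z)) : IsHFinite K W := by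
  obtain ⟨F, hF, hWF⟩ := hW
  obtain ⟨F', hF', hUF⟩ := hUZ
  -- The whole coset `H z` misses `U`, since a point of it in `U` would put `z` into `H F'`. Right
  -- multiplication by `f⁻¹ * z` therefore moves each point `h * f` of `W` out of `U`.
  obtain ⟨z, hz, hzF⟩ : ∃ z ∈ Z, z ∉ (H : Set G) * F' := by
    by_contra! h
    exact hZ' ⟨F', hF', h⟩
  refine (IsHFinite.biUnion hF fun f _ => hU.isHFinite_mul_notMem (f⁻¹ * z)).mono ?_
  intro x hx
  obtain ⟨h, hh, f, hf, rfl⟩ := hWF hx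
  refine Set.mem_biUnion hf ⟨hWU hx, fun hmem => hzF ?_⟩
  have hhz : h * z ∈ U := by simpa [mul_assoc] using hmem
  obtain ⟨k, hk, f', hf', hkf⟩ := hUF ⟨hhz, hZ h hh z hz⟩
  exact ⟨h⁻¹ * k, H.mul_mem (H.inv_mem hh) hk, f', hf', by
    simp only at hkf ⊢
    rw [mul_assoc, hkf, inv_mul_cancel_left]⟩

/-- `A` is a nontrivial almost invariant set over some subgroup. -/
def IsNontrivial (A : Set G) : Prop := ∃ H : Subgroup G, IsNontrivialAlmostInvariant H A

/-! ### Small intersections -/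

theorem IsNontrivial.compl {A : Set G} (h : IsNontrivial A) : IsNontrivial Aᶜ :=
  h.imp fun _ hH => hH.compl

/-- Each direction is the preceding transfer lemma with `W = U ∩ V`: the set over the old subgroup
plays the role of `Z`, the other one is the almost invariant set that is pushed off itself. -/
theorem isHFinite_inter_iff {H K : Subgroup G} {U V : Set G}
    (hU : IsNontrivialAlmostInvariant H U) (hV : IsNontrivialAlmostInvariant K V) :
    IsHFinite H (U ∩ V) ↔ IsHFinite K (U ∩ V) := by
  constructor
  · intro h
    exact hV.isHFinite_of_isHFinite hU.invariant hU.not_isHFinite Set.inter_subset_right h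
      (Set.inter_comm U V ▸ h)
  · intro h
    exact hU.isHFinite_of_isHFinite hV.invariant hV.not_isHFinite Set.inter_subset_left h h

theorem isSmallInter_iff {H : Subgroup G} {U V : Set G}
    (hU : IsNontrivialAlmostInvariant H U) (hV : IsNontrivial V) :
    IsSmallInter U V ↔ IsHFinite H (U ∩ V) := by
  obtain ⟨K, hV⟩ := hV
  refine ⟨?_, fun h => ⟨H, hU, h⟩⟩
  rintro ⟨H', hU', h⟩
  exact (isHFinite_inter_iff hU hV).mpr ((isHFinite_inter_iff hU' hV).mp h)

theorem IsSmallInter.symm {U V : Set G} (hV : IsNontrivial V) (h : IsSmallInter U V) :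
    IsSmallInter V U := by
  obtain ⟨K, hV⟩ := hV
  obtain ⟨H, hU, h⟩ := h
  refine ⟨K, hV, ?_⟩
  rw [Set.inter_comm]
  exact (isHFinite_inter_iff hU hV).mp h

theorem isSmallInter_of_eq_empty {U V : Set G} (hU : IsNontrivial U) (h : U ∩ V = ∅) :
    IsSmallInter U V := by
  obtain ⟨H, hU⟩ := hU
  exact ⟨H, hU, h ▸ isHFinite_empty H⟩

theorem isSmallInter_compl_of_subset {U V : Set G} (hU : IsNontrivial U) (h : U ⊆ V) :
    IsSmallInter U Vᶜ :=
  isSmallInter_of_eq_empty hU (Set.disjoint_compl_right_iff_subset.mpr h).inter_eq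

theorem IsSmallInter.not_compl_right {U V : Set G} (hU : IsNontrivial U) (hV : IsNontrivial V)
    (h : IsSmallInter U V) : ¬ IsSmallInter U Vᶜ := by
  intro h'
  obtain ⟨H, hU⟩ := hU
  rw [isSmallInter_iff hU hV] at h
  rw [isSmallInter_iff hU hV.compl] at h'
  refine hU.not_isHFinite ((h.union h').mono fun x hx => ?_)
  by_cases hxV : x ∈ V
  · exact Or.inl ⟨hx, hxV⟩
  · exact Or.inr ⟨hx, hxV⟩

theorem not_isSmallInter_self {U : Set G} (hU : IsNontrivial U) : ¬ IsSmallInter U U := by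
  intro h
  exact h.not_compl_right hU hU (isSmallInter_compl_of_subset hU subset_rfl)

/-- `U ∩ Dᶜ` is covered by `U ∩ Vᶜ` and `V ∩ Dᶜ`, which are both finite over the subgroup `K` of
`V`. The bound is then moved from `K` to the subgroup of `U`, with `Vᶜ` as the `K`-invariant set
that almost misses `U`. -/
theorem IsSmallInter.trans {U V D : Set G} (hU : IsNontrivial U) (hV : IsNontrivial V)
    (hD : IsNontrivial D) (hUV : IsSmallInter U Vᶜ) (hVD : IsSmallInter V Dᶜ) :
    IsSmallInter U Dᶜ := by
  obtain ⟨H, hU⟩ := hU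
  obtain ⟨K, hV⟩ := hV
  have hUV' : IsHFinite K (U ∩ Vᶜ) := by
    rw [← isHFinite_inter_iff hU hV.compl]
    exact (isSmallInter_iff hU ⟨K, hV.compl⟩).mp hUV
  have hVD' : IsHFinite K (V ∩ Dᶜ) := (isSmallInter_iff hV hD.compl).mp hVD
  refine ⟨H, hU, ?_⟩
  refine hU.isHFinite_of_isHFinite hV.compl.invariant hV.compl.not_isHFinite
    Set.inter_subset_left ((hUV'.union hVD').mono ?_) hUV'
  rintro x ⟨hxU, hxD⟩
  by_cases hxV : x ∈ V
  · exact Or.inr ⟨hxV, hxD⟩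
  · exact Or.inl ⟨hxU, hxV⟩

end HFinite

/-! ### Almost inclusion -/

section AlmostInclusion

variable {G : Type*} [Group G]

theorem almostLE_of_subset {U V : Set G} (h : U ⊆ V) : AlmostLE U V :=
  Or.inl (Set.disjoint_compl_right_iff_subset.mpr h).inter_eq

/-- Two small corners on the same side of `U` or of `V` would make that side finite modulo its
subgroup. So once `U ∩ Vᶜ` is small, only the opposite corner `Uᶜ ∩ V` can also be small. -/
theorem almostLE_iff {U V : Set G} (hU : IsNontrivial U) (hV : IsNontrivial V) :
    AlmostLE U V ↔ U ⊆ V ∨ IsSmallInter U Vᶜ ∧ ¬ IsSmallInter Uᶜ V := by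
  have hsub : corner U V (true, false) = ∅ ↔ U ⊆ V := by
    rw [← Set.disjoint_compl_right_iff_subset, Set.disjoint_iff_inter_eq_empty]
    rfl
  rw [AlmostLE, hsub]
  refine or_congr Iff.rfl ⟨fun h => ⟨(h (true, false)).mpr rfl, fun hc => ?_⟩, ?_⟩
  · simpa using (h (false, true)).mp hc
  · rintro ⟨h1, h2⟩ ⟨a, b⟩
    have h3 : ¬ IsSmallInter U V := fun h => h.not_compl_right hU hV h1
    have h4 : ¬ IsSmallInter Uᶜ Vᶜ := fun h =>
      (h.symm hV.compl).not_compl_right hV.compl hU.compl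
        (by rw [compl_compl]; exact h1.symm hV.compl)
    cases a <;> cases b <;> simp [IsSmallCorner, side, h1, h2, h3, h4]

theorem AlmostLE.isSmallInter {U V : Set G} (hU : IsNontrivial U) (hV : IsNontrivial V)
    (h : AlmostLE U V) : IsSmallInter U Vᶜ := by
  rw [almostLE_iff hU hV] at h
  rcases h with h | h
  · exact isSmallInter_compl_of_subset hU h
  · exact h.1

theorem not_almostLE_compl {U : Set G} (hU : IsNontrivial U) : ¬ AlmostLE U Uᶜ := by
  intro h
  have := h.isSmallInter hU hU.compl
  rw [compl_compl] at this
  exact not_isSmallInter_self hU this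

theorem AlmostLE.compl {U V : Set G} (hU : IsNontrivial U) (hV : IsNontrivial V)
    (h : AlmostLE U V) : AlmostLE Vᶜ Uᶜ := by
  rw [almostLE_iff hU hV] at h
  rw [almostLE_iff hV.compl hU.compl, Set.compl_subset_compl, compl_compl, compl_compl]
  refine h.imp_right fun h => ⟨h.1.symm hV.compl, fun h' => h.2 (h'.symm hU.compl)⟩

/-- Each relation makes one of the opposite corners `U ∩ Vᶜ`, `Uᶜ ∩ V` small, which rules out the
non-inclusion alternative for the other. -/
theorem AlmostLE.antisymm {U V : Set G} (hU : IsNontrivial U) (hV : IsNontrivial V)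
    (h : AlmostLE U V) (h' : AlmostLE V U) : U = V := by
  have hs := h.isSmallInter hU hV
  have hs' := h'.isSmallInter hV hU
  rw [almostLE_iff hU hV] at h
  rw [almostLE_iff hV hU] at h'
  rcases h with h | h
  · rcases h' with h' | h'
    · exact h.antisymm h'
    · exact absurd (hs.symm hV.compl) h'.2
  · exact absurd (hs'.symm hU.compl) h.2

theorem compl_mem_translates {n : ℕ} {X : Fin n → Set G} {A : Set G} (hA : A ∈ translates X) :
    Aᶜ ∈ translates X := by
  obtain ⟨i, g, rfl | rfl⟩ := hA
  · exact ⟨i, g, Or.inr Set.smul_set_compl.symm⟩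
  · exact ⟨i, g, Or.inl (by rw [← Set.smul_set_compl, compl_compl])⟩

theorem isNontrivial_of_mem_translates {n : ℕ} {H : Fin n → Subgroup G} {X : Fin n → Set G}
    (hX : ∀ i, IsNontrivialAlmostInvariant (H i) (X i)) {A : Set G} (hA : A ∈ translates X) :
    IsNontrivial A := by
  obtain ⟨i, g, rfl | rfl⟩ := hA
  · exact ⟨_, (hX i).smul g⟩
  · exact ⟨_, (hX i).compl.smul g⟩

theorem AlmostLE.trans {A B D : Set G} (nA : IsNontrivial A) (nB : IsNontrivial B)
    (nD : IsNontrivial D) (hAB : AlmostLE A B) (hBD : AlmostLE B D) : AlmostLE A D := by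
  have sAB := hAB.isSmallInter nA nB
  have sBD := hBD.isSmallInter nB nD
  have sAD := sAB.trans nA nB nD sBD
  rw [almostLE_iff nA nD]
  by_cases hs : IsSmallInter Aᶜ D
  -- Now `A`, `B`, `D` are almost contained in each other cyclically, so every corner opposite to a
  -- required one is small. Both given relations must be genuine inclusions.
  · have sDA : IsSmallInter D Aᶜ := hs.symm nD
    have sBA := sBD.trans nB nD nA sDA
    have sDB := sDA.trans nD nA nB sAB
    rw [almostLE_iff nA nB] at hAB
    rw [almostLE_iff nB nD] at hBD
    have h1 := hAB.resolve_right fun h => h.2 (sBA.symm nA.compl)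
    have h2 := hBD.resolve_right fun h => h.2 (sDB.symm nB.compl)
    exact Or.inl (h1.trans h2)
  · exact Or.inr ⟨sAD, hs⟩

end AlmostInclusion

/-! ### Faces of cubes -/

section Faces

universe u

/-- Unwinds the inductive filling of boundaries: a cube is an injective map on vertices that
respects the edges of the hypercube. In this form passing to arbitrary faces is immediate. -/
theorem isCube_iff {V : Type u} {Γ : SimpleGraph V} : ∀ {n : ℕ} {φ : (Fin n → Bool) → V},
    IsCube Γ n φ ↔ Function.Injective φ ∧
      ∀ y i, Γ.Adj (φ y) (φ (Function.update y i (!y i)))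
  | 0, φ => by
    simp only [IsCube, true_iff]
    exact ⟨Function.injective_of_subsingleton _, fun _ i => i.elim0⟩
  | 1, φ => by
    have hy : ∀ y : Fin 1 → Bool, y = (fun _ => false) ∨ y = (fun _ => true) := by
      intro y
      rcases h : y 0 with _ | _
      · exact Or.inl (funext fun i => by rw [Subsingleton.elim i 0, h])
      · exact Or.inr (funext fun i => by rw [Subsingleton.elim i 0, h])
    have hu : ∀ (y : Fin 1 → Bool) (i : Fin 1) (b : Bool),
        Function.update y i b = fun _ => b := by
      intro y i b
      funext j
      rw [Subsingleton.elim j i, Function.update_self]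
    simp only [IsCube, hu]
    constructor
    · intro h
      refine ⟨fun y y' hyy => ?_, fun y i => ?_⟩
      · rcases hy y with rfl | rfl <;> rcases hy y' with rfl | rfl
        · rfl
        · exact absurd hyy h.ne
        · exact absurd hyy.symm h.ne
        · rfl
      · rcases hy y with rfl | rfl
        · exact h
        · exact h.symm
    · exact fun h => h.2 (fun _ => false) 0
  | n + 2, φ => by
    simp only [IsCube]
    refine and_congr_right fun hφ => ⟨fun h y i => ?_, fun h i b => ?_⟩
    -- In dimension at least two, an edge in direction `i` lies in a facet orthogonal to some other
    -- direction `k`.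
    · obtain ⟨k, hk⟩ := exists_ne i
      have hc := (isCube_iff.mp (h k (y k))).2
      obtain ⟨j, rfl⟩ := Fin.exists_succAbove_eq hk.symm
      have := hc (k.removeNth y) j
      rw [Fin.insertNth_update, Fin.insertNth_self_removeNth] at this
      exact this
    · refine isCube_iff.mpr ⟨fun y y' hyy => ?_, fun y j => ?_⟩
      · exact Fin.insertNth_right_injective b (hφ hyy)
      · have := h (i.insertNth b y) (i.succAbove j)
        rw [Fin.insertNth_apply_succAbove, ← Fin.insertNth_update] at this
        exact this

/-! ### Composition and intersection of faces -/

variable {m n k : ℕ}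

@[simp]
theorem faceVertex_apply (e : Fin m ↪ Fin n) (c : Fin n → Bool) (x : Fin m → Bool) (i : Fin m) :
    faceVertex e c x (e i) = xor (c (e i)) (x i) := by
  simp [faceVertex, e.injective.extend_apply]

theorem faceVertex_of_notMem {e : Fin m ↪ Fin n} {j : Fin n} (hj : j ∉ Set.range e)
    (c : Fin n → Bool) (x : Fin m → Bool) : faceVertex e c x j = c j := by
  simp [faceVertex, Function.extend_apply' _ _ _ hj]

@[simp]
theorem facePoint_apply (e : Fin m ↪ Fin n) (c : Fin n → Bool) (x : Fin m → unitInterval)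
    (i : Fin m) :
    facePoint e c x (e i) = if c (e i) then unitInterval.symm (x i) else x i := by
  simp [facePoint, e.injective.extend_apply]

theorem facePoint_of_notMem {e : Fin m ↪ Fin n} {j : Fin n} (hj : j ∉ Set.range e)
    (c : Fin n → Bool) (x : Fin m → unitInterval) :
    facePoint e c x j = if c j then 1 else 0 := by
  simp [facePoint, Function.extend_apply' _ _ _ hj]

theorem faceVertex_injective (e : Fin m ↪ Fin n) (c : Fin n → Bool) :
    Function.Injective (faceVertex e c) := by
  intro x y h
  funext i
  simpa using congrFun h (e i)

theorem faceVertex_update (e : Fin m ↪ Fin n) (c : Fin n → Bool) (x : Fin m → Bool) (i : Fin m) :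
    faceVertex e c (Function.update x i (!x i))
      = Function.update (faceVertex e c x) (e i) (!faceVertex e c x (e i)) := by
  funext j
  by_cases hj : j ∈ Set.range e
  · obtain ⟨l, rfl⟩ := hj
    by_cases hl : l = i
    · subst hl
      simp
    · have hl' : e l ≠ e i := fun h => hl (e.injective h)
      simp [hl, hl']
  · have hj' : j ≠ e i := fun h => hj ⟨i, h.symm⟩
    simp [hj', faceVertex_of_notMem hj]

theorem IsCube.face {V : Type u} {Γ : SimpleGraph V} {φ : (Fin n → Bool) → V}
    (h : IsCube Γ n φ) (e : Fin m ↪ Fin n) (c : Fin n → Bool) :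
    IsCube Γ m fun y => φ (faceVertex e c y) := by
  rw [isCube_iff] at h ⊢
  refine ⟨h.1.comp (faceVertex_injective e c), fun y i => ?_⟩
  rw [faceVertex_update]
  exact h.2 _ _

theorem faceVertex_comp (e : Fin m ↪ Fin n) (c : Fin n → Bool) (e' : Fin k ↪ Fin m)
    (c' : Fin m → Bool) (y : Fin k → Bool) :
    faceVertex e c (faceVertex e' c' y) = faceVertex (e'.trans e) (faceVertex e c c') y := by
  funext j
  by_cases hj : j ∈ Set.range e
  · obtain ⟨l, rfl⟩ := hj
    by_cases hl : l ∈ Set.range e'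
    · obtain ⟨i, rfl⟩ := hl
      have := faceVertex_apply (e'.trans e) (faceVertex e c c') y i
      simp only [Function.Embedding.trans_apply] at this
      simp [this]
    · have hl' : e l ∉ Set.range (e'.trans e) := by
        rintro ⟨i, hi⟩
        exact hl ⟨i, e.injective hi⟩
      simp [faceVertex_of_notMem hl, faceVertex_of_notMem hl']
  · have hj' : j ∉ Set.range (e'.trans e) := fun ⟨i, hi⟩ => hj ⟨e' i, hi⟩
    simp [faceVertex_of_notMem hj, faceVertex_of_notMem hj']

theorem facePoint_comp (e : Fin m ↪ Fin n) (c : Fin n → Bool) (e' : Fin k ↪ Fin m)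
    (c' : Fin m → Bool) (y : Fin k → unitInterval) :
    facePoint e c (facePoint e' c' y) = facePoint (e'.trans e) (faceVertex e c c') y := by
  funext j
  by_cases hj : j ∈ Set.range e
  · obtain ⟨l, rfl⟩ := hj
    by_cases hl : l ∈ Set.range e'
    · obtain ⟨i, rfl⟩ := hl
      have := facePoint_apply (e'.trans e) (faceVertex e c c') y i
      simp only [Function.Embedding.trans_apply] at this
      rw [this]
      cases h1 : c (e (e' i)) <;> cases h2 : c' (e' i) <;> simp [h1, h2]
    · have hl' : e l ∉ Set.range (e'.trans e) := by
        rintro ⟨i, hi⟩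
        exact hl ⟨i, e.injective hi⟩
      rw [facePoint_of_notMem hl', facePoint_apply, facePoint_of_notMem hl]
      cases h1 : c (e l) <;> cases h2 : c' l <;> simp [h1, h2]
  · have hj' : j ∉ Set.range (e'.trans e) := fun ⟨i, hi⟩ => hj ⟨e' i, hi⟩
    simp [facePoint_of_notMem hj, facePoint_of_notMem hj', faceVertex_of_notMem hj]

@[simp]
theorem faceVertex_refl (y : Fin n → Bool) :
    faceVertex (Function.Embedding.refl _) (fun _ => false) y = y := by
  funext j
  simpa using faceVertex_apply (Function.Embedding.refl _) (fun _ => false) y j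

@[simp]
theorem facePoint_refl (y : Fin n → unitInterval) :
    facePoint (Function.Embedding.refl _) (fun _ => false) y = y := by
  funext j
  simpa using facePoint_apply (Function.Embedding.refl _) (fun _ => false) y j

theorem continuous_facePoint (e : Fin m ↪ Fin n) (c : Fin n → Bool) :
    Continuous (facePoint e c) := by
  refine continuous_pi fun j => ?_
  by_cases hj : j ∈ Set.range e
  · obtain ⟨i, rfl⟩ := hj
    simp only [facePoint_apply]
    split_ifs
    · exact unitInterval.continuous_symm.comp (continuous_apply i)
    · exact continuous_apply i
  · simp only [facePoint_of_notMem hj]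
    exact continuous_const

/-- Two faces of a cube that share a point intersect in a common face that contains it. -/
theorem exists_common_face {m₁ : ℕ} (e : Fin m ↪ Fin n) (c : Fin n → Bool)
    (y : Fin m → unitInterval) (e₁ : Fin m₁ ↪ Fin n) (c₁ : Fin n → Bool)
    (x : Fin m₁ → unitInterval) (h : facePoint e c y = facePoint e₁ c₁ x) :
    ∃ (k : ℕ) (e₂ : Fin k ↪ Fin m₁) (c₂ : Fin m₁ → Bool) (e₃ : Fin k ↪ Fin m)
      (c₃ : Fin m → Bool) (z : Fin k → unitInterval),
      facePoint e₂ c₂ z = x ∧ facePoint e₃ c₃ z = y ∧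
        ∀ w, faceVertex e c (faceVertex e₃ c₃ w) = faceVertex e₁ c₁ (faceVertex e₂ c₂ w) := by
  classical
  let K : Finset (Fin m₁) := {i | e₁ i ∈ Set.range e}
  let e₂ : Fin K.card ↪ Fin m₁ := (K.orderEmbOfFin rfl).toEmbedding
  have hr₂ : ∀ i, i ∈ Set.range e₂ ↔ e₁ i ∈ Set.range e := by
    intro i
    have : Set.range e₂ = K := Finset.range_orderEmbOfFin K rfl
    rw [this]
    simp [K]
  have hex : ∀ l, ∃ j, e j = e₁ (e₂ l) := fun l => (hr₂ _).mp ⟨l, rfl⟩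
  choose g hg using hex
  let e₃ : Fin K.card ↪ Fin m := ⟨g, fun a b hab => by
    have : e₁ (e₂ a) = e₁ (e₂ b) := by rw [← hg, ← hg, hab]
    exact e₂.injective (e₁.injective this)⟩
  have he₃ : ∀ l, e (e₃ l) = e₁ (e₂ l) := hg
  have hr₃ : ∀ j, j ∈ Set.range e₃ ↔ e j ∈ Set.range e₁ := by
    intro j
    constructor
    · rintro ⟨l, rfl⟩
      exact ⟨e₂ l, (he₃ l).symm⟩
    · rintro ⟨i, hi⟩
      obtain ⟨l, rfl⟩ := (hr₂ i).mpr ⟨j, hi.symm⟩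
      exact ⟨l, e.injective (by rw [he₃, hi])⟩
  -- The common face keeps the directions shared by both faces. Relative to `e₁` these are
  -- unreflected, so `z` is a restriction of `x`; relative to `e` they are reflected when `c` and
  -- `c₁` disagree. In the other directions of either face, the same exclusive or encodes the
  -- constant value imposed by the other face.
  refine ⟨K.card, e₂, fun i => if e₁ i ∈ Set.range e then false else xor (c₁ (e₁ i)) (c (e₁ i)),
    e₃, fun j => xor (c (e j)) (c₁ (e j)), fun l => x (e₂ l), ?_, ?_, fun w => ?_⟩
  · funext i
    by_cases hi : i ∈ Set.range e₂
    · have hi' := (hr₂ i).mp hi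
      obtain ⟨l, rfl⟩ := hi
      rw [facePoint_apply, if_pos hi']
      simp
    · have hi' := fun h' => hi ((hr₂ i).mpr h')
      rw [facePoint_of_notMem hi, if_neg hi']
      have := congrFun h (e₁ i)
      rw [facePoint_of_notMem hi', facePoint_apply] at this
      cases h1 : c (e₁ i) <;> cases h2 : c₁ (e₁ i) <;> simp [h1, h2] at this ⊢
      · exact this
      · rw [← unitInterval.symm_zero, this, unitInterval.symm_symm]
      · exact this
      · rw [← unitInterval.symm_one, this, unitInterval.symm_symm]
  · funext j
    have := congrFun h (e j)
    rw [facePoint_apply] at this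
    by_cases hj : j ∈ Set.range e₃
    · obtain ⟨l, rfl⟩ := hj
      rw [facePoint_apply]
      rw [he₃] at this ⊢
      rw [facePoint_apply] at this
      cases h1 : c (e₁ (e₂ l)) <;> cases h2 : c₁ (e₁ (e₂ l)) <;> simp [h1, h2] at this ⊢
      · exact this.symm
      · exact this.symm
      · rw [← this, unitInterval.symm_symm]
      · exact this.symm
    · have hj' := fun h' => hj ((hr₃ j).mpr h')
      rw [facePoint_of_notMem hj]
      rw [facePoint_of_notMem hj'] at this
      cases h1 : c (e j) <;> cases h2 : c₁ (e j) <;> simp [h1, h2] at this ⊢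
      · exact this.symm
      · exact this.symm
      · exact this.symm
      · exact this.symm
  · funext j
    by_cases hj : j ∈ Set.range e
    · obtain ⟨l, rfl⟩ := hj
      rw [faceVertex_apply]
      by_cases hl : l ∈ Set.range e₃
      · obtain ⟨a, rfl⟩ := hl
        have h3 : e₁ (e₂ a) ∈ Set.range e := ⟨e₃ a, he₃ a⟩
        rw [faceVertex_apply, he₃, faceVertex_apply, faceVertex_apply, if_pos h3]
        cases c (e₁ (e₂ a)) <;> simp
      · have hl' := fun h' => hl ((hr₃ l).mpr h')
        rw [faceVertex_of_notMem hl, faceVertex_of_notMem hl']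
        cases c (e l) <;> simp
    · rw [faceVertex_of_notMem hj]
      by_cases hj' : j ∈ Set.range e₁
      · obtain ⟨l, rfl⟩ := hj'
        have hl : l ∉ Set.range e₂ := fun h' => hj ((hr₂ l).mp h')
        rw [faceVertex_apply, faceVertex_of_notMem hl, if_neg hj]
        cases c₁ (e₁ l) <;> simp
      · rw [faceVertex_of_notMem hj']
        -- coordinates fixed by both faces agree because the faces share a point
        have := congrFun h j
        rw [facePoint_of_notMem hj, facePoint_of_notMem hj'] at this
        cases h1 : c j <;> cases h2 : c₁ j <;> simp [h1, h2] at this ⊢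

end Faces

/-! ### The map induced by an injective graph homomorphism is a closed embedding -/

section Embedding

universe u v

variable {V : Type u} {V' : Type v} {Γ : SimpleGraph V} {Γ' : SimpleGraph V'}

/-- The point `p` lies in a face of its cube that is the image under `f` of a cube of `Γ`, and `a`
is the corresponding point of the realization of `Γ`. -/
def FaceLift (f : Γ.Copy Γ') (p : CubePoint Γ') (a : Realization Γ) : Prop :=
  ∃ (m : ℕ) (ψ : {ψ : (Fin m → Bool) → V // IsCube Γ m ψ}) (e : Fin m ↪ Fin p.1.1)
    (c : Fin p.1.1 → Bool) (y : Fin m → unitInterval),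
    (∀ w, f (ψ.1 w) = p.1.2.1 (faceVertex e c w)) ∧ facePoint e c y = p.2 ∧
      a = Quot.mk _ ⟨⟨m, ψ⟩, y⟩

theorem faceLift_map (f : Γ.Copy Γ') (p : CubePoint Γ) :
    FaceLift f ⟨p.1.map f, p.2⟩ (Quot.mk _ p) :=
  ⟨p.1.1, p.1.2, Function.Embedding.refl _, fun _ => false, p.2,
    fun w => congrArg (fun w => f (p.1.2.1 w)) (faceVertex_refl w).symm, facePoint_refl _, rfl⟩

theorem FaceLift.mk_eq {f : Γ.Copy Γ'} {p : CubePoint Γ'} {a : Realization Γ}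
    (h : FaceLift f p a) : Realization.map f a = Quot.mk _ p := by
  obtain ⟨⟨n, φ⟩, x⟩ := p
  obtain ⟨m, ψ, e, c, y, hv, hy, rfl⟩ := h
  exact (Quot.sound (Glue.face (m := m) (n := n) ⟨fun w => f (ψ.1 w), ψ.2.map f⟩ φ e c hv y)).trans
    (congrArg (fun x => Quot.mk (Glue Γ') ⟨⟨n, φ⟩, x⟩) hy)

theorem FaceLift.eq_mk {f : Γ.Copy Γ'} {q : CubePoint Γ} {a : Realization Γ}
    (h : FaceLift f ⟨q.1.map f, q.2⟩ a) : a = Quot.mk _ q := by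
  obtain ⟨⟨n, φ⟩, x⟩ := q
  obtain ⟨m, ψ, e, c, y, hv, hy, rfl⟩ := h
  exact (Quot.sound (Glue.face ψ φ e c (fun w => f.injective (hv w)) y)).trans
    (congrArg (fun x => Quot.mk (Glue Γ) ⟨⟨n, φ⟩, x⟩) hy)

/-- Upwards, a face of a face is a face. Downwards, the lifted face and the glued face share a
point, so they meet in a common face, whose lift is a face of the given lift. -/
theorem Glue.faceLift_iff (f : Γ.Copy Γ') {p q : CubePoint Γ'} (h : Glue Γ' p q)
    (a : Realization Γ) : FaceLift f p a ↔ FaceLift f q a := by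
  obtain ⟨ψ', φ', e₁, c₁, h₁, x⟩ := h
  constructor
  · rintro ⟨m, ψ, e, c, y, hv, hy, rfl⟩
    refine ⟨m, ψ, e.trans e₁, faceVertex e₁ c₁ c, y, fun w => ?_, ?_, rfl⟩
    · rw [hv, ← faceVertex_comp]
      exact h₁ _
    · rw [← facePoint_comp, hy]
  · rintro ⟨m, ψ, e, c, y, hv, hy, rfl⟩
    obtain ⟨k, e₂, c₂, e₃, c₃, z, hx, rfl, hw⟩ := exists_common_face e c y e₁ c₁ x hy
    refine ⟨k, ⟨_, ψ.2.face e₃ c₃⟩, e₂, c₂, z, fun w => ?_, hx, ?_⟩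
    · simp only [hv, hw, h₁]
    · exact (Quot.sound (Glue.face ⟨_, ψ.2.face e₃ c₃⟩ ψ e₃ c₃ (fun _ => rfl) z)).symm

/-- Replaces the generated equivalence relation on the target by a condition inside one cube.
`FaceLift` is constant along chains of gluings and holds for the tautological lift. -/
theorem mk_eq_map_iff (f : Γ.Copy Γ') (p : CubePoint Γ') (a : Realization Γ) :
    Quot.mk _ p = Realization.map f a ↔ FaceLift f p a := by
  refine ⟨fun h => ?_, fun h => h.mk_eq.symm⟩
  induction a using Quot.inductionOn with | _ q
  have hq := faceLift_map f q
  have h' : Relation.EqvGen (Glue Γ') p ⟨q.1.map f, q.2⟩ := Quot.eqvGen_exact h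
  suffices H : ∀ q', Relation.EqvGen (Glue Γ') p q' →
      ∀ a, FaceLift f p a ↔ FaceLift f q' a from (H _ h' _).mpr hq
  clear h h' hq
  intro q' hq' a
  induction hq' with
  | rel _ _ h => exact h.faceLift_iff f a
  | refl => rfl
  | symm _ _ _ ih => exact ih.symm
  | trans _ _ _ _ _ ih ih' => exact ih.trans ih'

theorem Realization.map_injective (f : Γ.Copy Γ') : Function.Injective (Realization.map f) := by
  intro a b h
  induction b using Quot.inductionOn with | _ q
  exact ((mk_eq_map_iff f ⟨q.1.map f, q.2⟩ a).mp h.symm).eq_mk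

theorem Realization.continuous_map (f : Γ.Copy Γ') : Continuous (Realization.map f) := by
  refine continuous_quot_lift _ (continuous_quot_mk.comp ?_)
  exact continuous_sigma fun σ => continuous_sigmaMk (σ := fun σ : Cell Γ' => Fin σ.1 → unitInterval)
    (i := σ.map f)

/-- In each target cube, the preimage of the image is a finite union, over the parametrised faces
that lift, of images of closed subsets of compact cubes. -/
theorem Realization.isClosedMap_map (f : Γ.Copy Γ') : IsClosedMap (Realization.map f) := by
  intro A hA
  have hA' : IsClosed ((Quot.mk (Glue Γ)) ⁻¹' A) := hA.preimage continuous_quot_mk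
  rw [isClosed_sigma_iff] at hA'
  have key : IsClosed ((Quot.mk (Glue Γ')) ⁻¹' (Realization.map f '' A)) := by
    rw [isClosed_sigma_iff]
    rintro ⟨n, φ⟩
    have hset : (Sigma.mk (β := fun σ : Cell Γ' => Fin σ.1 → unitInterval) ⟨n, φ⟩) ⁻¹'
        ((Quot.mk (Glue Γ')) ⁻¹' (Realization.map f '' A))
        = ⋃ m : Fin (n + 1), ⋃ e : Fin m ↪ Fin n, ⋃ c : Fin n → Bool,
          {x | ∃ ψ : {ψ : (Fin m → Bool) → V // IsCube Γ m ψ},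
            (∀ w, f (ψ.1 w) = φ.1 (faceVertex e c w)) ∧
            x ∈ facePoint e c '' {y | Quot.mk (Glue Γ) ⟨⟨m, ψ⟩, y⟩ ∈ A}} := by
      ext x
      simp only [Set.mem_preimage, Set.mem_image, Set.mem_iUnion]
      constructor
      · rintro ⟨a, ha, hax⟩
        obtain ⟨m, ψ, e, c, y, hv, hy, rfl⟩ := (mk_eq_map_iff f ⟨⟨n, φ⟩, x⟩ a).mp hax.symm
        have hm : m ≤ n := by simpa using Fintype.card_le_of_embedding e
        exact ⟨⟨m, Nat.lt_succ_of_le hm⟩, e, c, ψ, hv, y, ha, hy⟩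
      · rintro ⟨m, e, c, ψ, hv, y, ha, hy⟩
        exact ⟨_, ha, FaceLift.mk_eq (p := ⟨⟨n, φ⟩, x⟩) ⟨m, ψ, e, c, y, hv, hy, rfl⟩⟩
    rw [hset]
    refine isClosed_iUnion_of_finite fun m => isClosed_iUnion_of_finite fun e =>
      isClosed_iUnion_of_finite fun c => ?_
    -- As `f` is injective, at most one cube `ψ` lifts this parametrised face, so the existential
    -- over `ψ` does not produce an infinite union.
    by_cases hψ : ∃ ψ : {ψ : (Fin m → Bool) → V // IsCube Γ m ψ},
        ∀ w, f (ψ.1 w) = φ.1 (faceVertex e c w)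
    · obtain ⟨ψ, hv⟩ := hψ
      convert (continuous_facePoint e c).isClosedMap _ (hA' ⟨m, ψ⟩) using 1
      ext x
      constructor
      · rintro ⟨ψ', hv', hx⟩
        obtain rfl : ψ' = ψ := Subtype.ext (funext fun w => f.injective ((hv' w).trans (hv w).symm))
        exact hx
      · exact fun hx => ⟨ψ, hv, hx⟩
    · convert isClosed_empty
      exact Set.eq_empty_of_forall_notMem fun x ⟨ψ, hv, _⟩ => hψ ⟨ψ, hv⟩
  exact isQuotientMap_quot_mk.isClosed_preimage.mp key

/-- The map induced by an injective graph homomorphism embeds the realization as a closed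
subcomplex. -/
theorem Realization.isClosedEmbedding_map (f : Γ.Copy Γ') :
    Topology.IsClosedEmbedding (Realization.map f) :=
  .of_continuous_injective_isClosedMap (Realization.continuous_map f)
    (Realization.map_injective f) (Realization.isClosedMap_map f)

end Embedding

/-! ### Components of the graph of ultrafilters -/

theorem exists_minimal_of_finite {α : Type*} {s : Set α} (hs : s.Finite) (hne : s.Nonempty)
    {r : α → α → Prop} (htrans : ∀ a ∈ s, ∀ b ∈ s, ∀ c ∈ s, r a b → r b c → r a c)
    (hanti : ∀ a ∈ s, ∀ b ∈ s, r a b → r b a → a = b) :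
    ∃ a ∈ s, ∀ b ∈ s, r b a → b = a := by
  induction s, hs using Set.Finite.induction_on with
  | empty => exact absurd hne Set.not_nonempty_empty
  | @insert a t _ _ ih =>
    rcases t.eq_empty_or_nonempty with rfl | ht
    · exact ⟨a, by simp, by simp⟩
    · obtain ⟨m, hm, hmin⟩ := ih ht
        (fun a ha b hb c hc => htrans a (.inr ha) b (.inr hb) c (.inr hc))
        (fun a ha b hb => hanti a (.inr ha) b (.inr hb))
      by_cases ham : r a m
      · refine ⟨a, .inl rfl, ?_⟩
        rintro b (rfl | hb) hba
        · rfl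
        · have hbm := hmin b hb (htrans b (.inr hb) a (.inl rfl) m (.inr hm) hba ham)
          subst hbm
          exact hanti b (.inr hb) a (.inl rfl) hba ham
      · refine ⟨m, .inr hm, ?_⟩
        rintro b (rfl | hb) hbm
        · exact absurd hbm ham
        · exact hmin b hb hbm

theorem IsUltrafilterOn.compl_mem_iff {G : Type*} {E : Set (Set G)} {r : Set G → Set G → Prop}
    {V : Set (Set G)} (hV : IsUltrafilterOn E r V) {A : Set G} (hA : A ∈ E) :
    Aᶜ ∈ V ↔ A ∉ V := by
  have := hV.mem_xor A hA
  tauto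

theorem IsUltrafilterOn.eq_of_subset {G : Type*} {E : Set (Set G)} {r : Set G → Set G → Prop}
    {V V' : Set (Set G)} (hV : IsUltrafilterOn E r V) (hV' : IsUltrafilterOn E r V')
    (h : V ⊆ V') : V = V' := by
  refine h.antisymm fun A hA => ?_
  by_contra hAV
  have hE := hV'.subset hA
  exact (hV'.compl_mem_iff hE).mp (h ((hV.compl_mem_iff hE).mpr hAV)) hA

section Components

variable {G : Type*} [Group G]

/-- The relation of `D` is a partial order on `D.E`, reversed by complementation. -/
structure CubingData.IsPocset (D : CubingData G) : Prop where
  compl_mem : ∀ A ∈ D.E, Aᶜ ∈ D.E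
  antisymm : ∀ A ∈ D.E, ∀ B ∈ D.E, D.rel A B → D.rel B A → A = B
  trans : ∀ A ∈ D.E, ∀ B ∈ D.E, ∀ C ∈ D.E, D.rel A B → D.rel B C → D.rel A C
  compl : ∀ A ∈ D.E, ∀ B ∈ D.E, D.rel A B → D.rel Bᶜ Aᶜ

/-- Replacing an element that is minimal among those not in `V'` by its complement. -/
theorem IsUltrafilterOn.flip {D : CubingData G} (hD : D.IsPocset) {V V' : Set (Set G)}
    (hV : IsUltrafilterOn D.E D.rel V) (hV' : IsUltrafilterOn D.E D.rel V') {A : Set G}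
    (hA : A ∈ V \ V') (hmin : ∀ B ∈ V \ V', D.rel B A → B = A) :
    IsUltrafilterOn D.E D.rel ((V \ {A}) ∪ {Aᶜ}) := by
  have hAE := hV.subset hA.1
  -- Minimality in `V \ V'` extends to all of `V`: an element of `V ∩ V'` below `A` would force `A ∈
  -- V'`.
  have hbelow : ∀ B ∈ V, D.rel B A → B = A := by
    intro B hB hBA
    by_cases hB' : B ∈ V'
    · exact absurd (hV'.upward B hB' A hAE hBA) hA.2
    · exact hmin B ⟨hB, hB'⟩ hBA
  have hAc : Aᶜ ∈ V' := (hV'.compl_mem_iff hAE).mpr hA.2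
  have hAne : A ≠ Aᶜ := fun h => (hV.compl_mem_iff hAE).mp (h ▸ hA.1) hA.1
  constructor
  · rintro B (hB | rfl)
    · exact hV.subset hB.1
    · exact hD.compl_mem A hAE
  · intro B hB
    have hx := hV.mem_xor B hB
    have h1 : Bᶜ = A ↔ B = Aᶜ := by
      constructor <;> rintro rfl <;> simp
    have h2 : Bᶜ = Aᶜ ↔ B = A := compl_inj_iff
    simp only [Set.mem_union, Set.mem_sdiff, Set.mem_singleton_iff, h1, h2]
    have h3 : ¬ (B = A ∧ B = Aᶜ) := fun h => hAne (h.1.symm.trans h.2)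
    tauto
  · rintro B hB C hC hBC
    have hCV : C ∈ V ∨ C = Aᶜ := by
      rcases hB with hB | rfl
      · exact Or.inl (hV.upward B hB.1 C hC hBC)
      · by_contra! hcon
        have hCc := (hV.compl_mem_iff hC).mpr hcon.1
        have := hD.compl _ (hD.compl_mem A hAE) C hC hBC
        rw [compl_compl] at this
        have := hbelow _ hCc this
        exact hcon.2 (by rw [← this, compl_compl])
    have hCA : C ≠ A := by
      rintro rfl
      rcases hB with hB | rfl
      · exact hB.2 (hbelow B hB.1 hBC)
      · exact hA.2 (hV'.upward _ hAc C hC hBC)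
    rcases hCV with h | h
    · exact Or.inl ⟨h, hCA⟩
    · exact Or.inr h

/-- Flipping a minimal element of `V \ V'` gives an adjacent ultrafilter, and removes exactly that
element from the finite difference. -/
theorem CubingData.IsPocset.reachable {D : CubingData G} (hD : D.IsPocset) (V V' : D.Ultra)
    (hfin : (V.1 \ V'.1).Finite) : D.fullGraph.Reachable V V' := by
  induction hN : (V.1 \ V'.1).ncard using Nat.strong_induction_on generalizing V with
  | _ N ih =>
    rcases (V.1 \ V'.1).eq_empty_or_nonempty with he | hne
    · rw [Subtype.ext (V.2.eq_of_subset V'.2 (Set.sdiff_eq_empty.mp he))]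
    · have hE : ∀ A ∈ V.1 \ V'.1, A ∈ D.E := fun A hA => V.2.subset hA.1
      obtain ⟨A, hA, hmin⟩ := exists_minimal_of_finite hfin hne
        (fun a ha b hb c hc => hD.trans a (hE a ha) b (hE b hb) c (hE c hc))
        (fun a ha b hb => hD.antisymm a (hE a ha) b (hE b hb))
      let V₁ : D.Ultra := ⟨_, V.2.flip hD V'.2 hA hmin⟩
      have hadj : D.fullGraph.Adj V V₁ := ⟨A, hA.1, rfl⟩
      have hsub : V₁.1 \ V'.1 ⊂ V.1 \ V'.1 := by
        refine ⟨?_, fun h => ?_⟩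
        · rintro B ⟨hB | rfl, hB'⟩
          · exact ⟨hB.1, hB'⟩
          · exact absurd ((V'.2.compl_mem_iff (hE A hA)).mpr hA.2) hB'
        · rcases (h hA).1 with h | h
          · exact h.2 rfl
          · have h' : A = Aᶜ := h
            exact (V.2.compl_mem_iff (hE A hA)).mp (h' ▸ hA.1) hA.1
      exact hadj.reachable.trans
        (ih _ (hN ▸ Set.ncard_lt_ncard hsub hfin) V₁ (hfin.subset hsub.1) rfl)

theorem CubingData.reachable_lift {D : CubingData G} (v : D.Vertex) {w : D.Ultra}
    (h : D.fullGraph.Reachable v.1 w) : ∃ hw, D.graph.Reachable v ⟨w, hw⟩ := by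
  rw [SimpleGraph.reachable_iff_reflTransGen] at h
  induction h with
  | refl => exact ⟨v.2, SimpleGraph.Reachable.refl _⟩
  | @tail b c _ hbc ih =>
    obtain ⟨hb, hvb⟩ := ih
    obtain ⟨W, hW, hWb⟩ := id hb
    have hadj : D.graph.Adj ⟨b, hb⟩ ⟨c, W, hW, hWb.trans hbc.reachable⟩ := hbc
    exact ⟨⟨W, hW, hWb.trans hbc.reachable⟩, hvb.trans hadj.reachable⟩

theorem CubingData.graph_connected {D : CubingData G} (hne : ∃ W : D.Ultra, W.1 ∈ D.basic)
    (h : ∀ W W' : D.Ultra, W.1 ∈ D.basic → W'.1 ∈ D.basic → D.fullGraph.Reachable W W') :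
    D.graph.Connected := by
  obtain ⟨W₀, hW₀⟩ := hne
  rw [SimpleGraph.connected_iff]
  refine ⟨fun v w => ?_, ⟨⟨W₀, W₀, hW₀, SimpleGraph.Reachable.refl _⟩⟩⟩
  obtain ⟨W, hW, hWv⟩ := v.2
  obtain ⟨W', hW', hWw⟩ := w.2
  obtain ⟨_, hvw⟩ := D.reachable_lift v (hWv.symm.trans ((h W W' hW hW').trans hWw))
  exact hvw

end Components

/-! ### Boundaries in the Cayley graph -/

section Boundary

variable {G : Type*} [Group G] {S : Set G}

/-- The endpoints of the edges of the coboundary of `A`. -/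
def boundary (S A : Set G) : Set G := {v | ∃ e ∈ coboundary S A, v ∈ e}

theorem mem_boundary_iff {A : Set G} {v : G} :
    v ∈ boundary S A ↔ ∃ w, (SimpleGraph.mulCayley S).Adj v w ∧ ¬ (v ∈ A ↔ w ∈ A) := by
  constructor
  · rintro ⟨_, ⟨a, ha, b, hb, hab, rfl⟩, hv⟩
    rw [Set.mem_compl_iff] at hb
    rcases Sym2.mem_iff.mp hv with rfl | rfl
    · exact ⟨b, hab, by tauto⟩
    · exact ⟨a, hab.symm, by tauto⟩
  · rintro ⟨w, hvw, h⟩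
    by_cases hv : v ∈ A
    · exact ⟨s(v, w), ⟨v, hv, w, fun hw => h (by tauto), hvw, rfl⟩, Sym2.mem_mk_left _ _⟩
    · exact ⟨s(w, v), ⟨w, by tauto, v, hv, hvw.symm, rfl⟩, Sym2.mem_mk_right _ _⟩

theorem mem_iff_of_notMem_boundary {A : Set G} {v w : G} (hv : v ∉ boundary S A)
    (h : (SimpleGraph.mulCayley S).Adj v w) : v ∈ A ↔ w ∈ A := by
  by_contra hcon
  exact hv (mem_boundary_iff.mpr ⟨w, h, hcon⟩)

@[simp]
theorem boundary_compl (A : Set G) : boundary S Aᶜ = boundary S A := by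
  ext v
  simp only [mem_boundary_iff, Set.mem_compl_iff, not_iff_not]

theorem boundary_side (A : Set G) (b : Bool) : boundary S (side A b) = boundary S A := by
  cases b
  · exact boundary_compl A
  · rfl

theorem mem_boundary_smul_iff {A : Set G} {k v : G} :
    v ∈ boundary S (k • A) ↔ k⁻¹ * v ∈ boundary S A := by
  simp only [mem_boundary_iff, Set.mem_smul_set_iff_inv_smul_mem, smul_eq_mul]
  constructor
  · rintro ⟨w, hvw, h⟩
    exact ⟨k⁻¹ * w, mulCayley_adj_smul S k⁻¹ hvw, h⟩
  · rintro ⟨w, hvw, h⟩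
    refine ⟨k * w, ?_, by simpa using h⟩
    simpa using mulCayley_adj_smul S k hvw

theorem mem_nearSets_iff {n : ℕ} {X : Fin n → Set G} {R : ℕ} {g : G} {A : Set G} :
    A ∈ nearSets X S R g ↔ A ∈ translates X ∧ ∃ v ∈ ball S R g, v ∈ boundary S A := by
  constructor
  · rintro ⟨hA, e, he, v, hv, hve⟩
    exact ⟨hA, v, hv, e, he, hve⟩
  · rintro ⟨hA, v, hv, e, he, hve⟩
    exact ⟨hA, e, he, v, hv, hve⟩

theorem exists_eq_mul_of_mulCayley_adj {v w : G} : (SimpleGraph.mulCayley S).Adj v w →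
    ∃ s ∈ S ∪ S⁻¹, w = v * s := by
  rw [SimpleGraph.mulCayley_adj]
  rintro ⟨_, h | h⟩
  · exact ⟨_, Or.inl h, by simp⟩
  · exact ⟨v⁻¹ * w, Or.inr (by simpa using h), by simp⟩

theorem IsNontrivialAlmostInvariant.isHFinite_boundary {H : Subgroup G} {X : Set G}
    (hX : IsNontrivialAlmostInvariant H X) (hS : S.Finite) : IsHFinite H (boundary S X) := by
  refine (IsHFinite.biUnion (hS.union hS.inv) fun s _ =>
    (hX.isHFinite_mul_notMem s).union (hX.compl.isHFinite_mul_notMem s)).mono ?_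
  intro v hv
  obtain ⟨w, hvw, h⟩ := mem_boundary_iff.mp hv
  obtain ⟨s, hs, rfl⟩ := exists_eq_mul_of_mulCayley_adj hvw
  refine Set.mem_biUnion hs ?_
  by_cases hvX : v ∈ X
  · exact Or.inl ⟨hvX, by tauto⟩
  · exact Or.inr ⟨hvX, fun h' => h (by simp only [Set.mem_compl_iff] at h'; tauto)⟩

theorem IsNontrivialAlmostInvariant.smul_eq {H : Subgroup G} {X : Set G}
    (hX : IsNontrivialAlmostInvariant H X) {h : G} (hh : h ∈ H) : h • X = X := by
  ext x
  rw [Set.mem_smul_set_iff_inv_smul_mem]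
  exact hX.mul_mem_iff (H.inv_mem hh)

theorem IsNontrivialAlmostInvariant.side {H : Subgroup G} {X : Set G}
    (hX : IsNontrivialAlmostInvariant H X) (b : Bool) :
    IsNontrivialAlmostInvariant H (side X b) := by
  cases b
  · exact hX.compl
  · exact hX

theorem mem_translates_iff {n : ℕ} {X : Fin n → Set G} {A : Set G} :
    A ∈ translates X ↔ ∃ (i : Fin n) (b : Bool) (g : G), A = g • side (X i) b := by
  constructor
  · rintro ⟨i, g, h | h⟩
    · exact ⟨i, true, g, h⟩
    · exact ⟨i, false, g, h⟩
  · rintro ⟨i, _ | _, g, h⟩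
    · exact ⟨i, g, Or.inr h⟩
    · exact ⟨i, g, Or.inl h⟩

/-! ### Local finiteness of the family of translates -/

theorem IsNontrivialAlmostInvariant.finite_smul {H : Subgroup G} {X Z : Set G}
    (hX : IsNontrivialAlmostInvariant H X) (hZ : IsHFinite H Z) (v : G) :
    {A | ∃ k : G, A = k • X ∧ k⁻¹ * v ∈ Z}.Finite := by
  obtain ⟨F, hF, hZF⟩ := hZ
  refine (hF.image fun f => (v * f⁻¹) • X).subset ?_
  rintro _ ⟨k, rfl, hk⟩
  obtain ⟨h, hh, f, hf, hkf⟩ := hZF hk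
  refine ⟨f, hf, ?_⟩
  -- From `k⁻¹ * v = h * f`; the factor `h` fixes `X`, so the translate depends only on `f`.
  have hk' : v * f⁻¹ = k * h := by
    simp only at hkf
    rw [mul_inv_eq_iff_eq_mul, mul_assoc, hkf, mul_inv_cancel_left]
  simp only [hk', mul_smul, hX.smul_eq hh]

theorem finite_separating {n : ℕ} {H : Fin n → Subgroup G} {X : Fin n → Set G}
    (hX : ∀ i, IsNontrivialAlmostInvariant (H i) (X i)) (g h : G) :
    {A ∈ translates X | g ∈ A ∧ h ∉ A}.Finite := by
  refine (Set.finite_iUnion fun i => Set.finite_iUnion fun b => ((hX i).side b).finite_smul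
    (((hX i).side b).isHFinite_mul_notMem (g⁻¹ * h)) g).subset ?_
  rintro A ⟨hA, hg, hh⟩
  obtain ⟨i, b, k, rfl⟩ := mem_translates_iff.mp hA
  rw [Set.mem_smul_set_iff_inv_smul_mem] at hg hh
  refine Set.mem_iUnion₂.mpr ⟨i, b, k, rfl, hg, ?_⟩
  simpa [mul_assoc] using hh

theorem exists_walk_of_mem_ball {R : ℕ} {g h : G} (hh : h ∈ ball S R g) :
    ∃ p : (SimpleGraph.mulCayley S).Walk g h, p.length ≤ R := by
  have hh' : (SimpleGraph.mulCayley S).edist g h ≤ R := hh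
  obtain ⟨p, hp⟩ := SimpleGraph.exists_walk_of_edist_ne_top (ne_top_of_le_ne_top (by simp) hh')
  exact ⟨p, by exact_mod_cast hp ▸ hh'⟩

theorem finite_ball (hS : S.Finite) (R : ℕ) (g : G) : (ball S R g).Finite := by
  have key : ∀ (N : ℕ) (g : G),
      {h | ∃ p : (SimpleGraph.mulCayley S).Walk g h, p.length ≤ N}.Finite := by
    intro N
    induction N with
    | zero =>
      intro g
      refine (Set.finite_singleton g).subset ?_
      rintro h ⟨p, hp⟩
      exact (SimpleGraph.Walk.eq_of_length_eq_zero (Nat.le_zero.mp hp)).symm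
    | succ N ih =>
      intro g
      refine ((Set.finite_singleton g).union
        ((hS.union hS.inv).biUnion fun s _ => ih (g * s))).subset ?_
      rintro h ⟨p, hp⟩
      cases p with
      | nil => exact Or.inl rfl
      | cons hadj q =>
        obtain ⟨s, hs, rfl⟩ := exists_eq_mul_of_mulCayley_adj hadj
        rw [SimpleGraph.Walk.length_cons] at hp
        exact Or.inr (Set.mem_biUnion hs ⟨q, by omega⟩)
  exact (key R g).subset fun h hh => exists_walk_of_mem_ball hh

theorem finite_nearSets {n : ℕ} {H : Fin n → Subgroup G} {X : Fin n → Set G}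
    (hX : ∀ i, IsNontrivialAlmostInvariant (H i) (X i)) (hS : S.Finite) (R : ℕ) (g : G) :
    (nearSets X S R g).Finite := by
  refine ((finite_ball hS R g).biUnion fun v _ => Set.finite_iUnion fun i =>
    Set.finite_iUnion fun b => ((hX i).side b).finite_smul
      (((hX i).side b).isHFinite_boundary hS) v).subset ?_
  intro A hA
  obtain ⟨hA, v, hv, hvA⟩ := mem_nearSets_iff.mp hA
  obtain ⟨i, b, k, rfl⟩ := mem_translates_iff.mp hA
  exact Set.mem_biUnion hv (Set.mem_iUnion₂.mpr ⟨i, b, k, rfl, mem_boundary_smul_iff.mp hvA⟩)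

theorem compl_mem_nearSets_iff {n : ℕ} {X : Fin n → Set G} {R : ℕ} {g : G} {A : Set G} :
    Aᶜ ∈ nearSets X S R g ↔ A ∈ nearSets X S R g := by
  simp only [mem_nearSets_iff, boundary_compl]
  exact and_congr_left fun _ => ⟨fun h => by simpa using compl_mem_translates h,
    compl_mem_translates⟩

theorem walk_mem_of_support {A : Set G} {g h : G} (p : (SimpleGraph.mulCayley S).Walk g h)
    (hp : ∀ v ∈ p.support, v ∉ boundary S A) (hg : g ∈ A) : h ∈ A := by
  induction p with
  | nil => exact hg
  | cons hadj q ih =>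
    refine ih (fun v hv => hp v (by simp [hv])) ?_
    exact (mem_iff_of_notMem_boundary (hp _ (by simp)) hadj).mp hg

theorem ball_subset_of_notMem_nearSets {n : ℕ} {X : Fin n → Set G} {R : ℕ} {g : G} {A : Set G}
    (hA : A ∈ translates X) (hA' : A ∉ nearSets X S R g) (hg : g ∈ A) : ball S R g ⊆ A := by
  classical
  intro h hh
  obtain ⟨p, hp⟩ := exists_walk_of_mem_ball hh
  refine walk_mem_of_support p (fun v hv hvA => hA' ?_) hg
  refine mem_nearSets_iff.mpr ⟨hA, v, ?_, hvA⟩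
  have h1 := SimpleGraph.edist_le (p.takeUntil v hv)
  have h2 := p.length_takeUntil_le_length hv
  exact h1.trans (by exact_mod_cast h2.trans hp)

/-! ### Admissible radii -/

theorem exists_mul_mem_ball (hSG : Subgroup.closure S = ⊤) (t : G) :
    ∃ N : ℕ, ∀ g : G, g * t ∈ ball S N g := by
  have ht : t ∈ Subgroup.closure S := hSG ▸ Subgroup.mem_top t
  induction ht using Subgroup.closure_induction with
  | mem s hs =>
    refine ⟨1, fun g => ?_⟩
    by_cases hgs : g = g * s
    · have : (SimpleGraph.mulCayley S).edist g (g * s) = 0 := by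
        rw [← hgs, SimpleGraph.edist_self]
      exact this.le.trans zero_le
    · have hadj : (SimpleGraph.mulCayley S).Adj g (g * s) :=
        (SimpleGraph.mulCayley_adj' S _ _).mpr ⟨hgs, s, hs, Or.inl rfl⟩
      exact (SimpleGraph.edist_le hadj.toWalk).trans (by simp)
  | one => exact ⟨0, fun g => by simp [ball]⟩
  | mul a b _ _ iha ihb =>
    obtain ⟨M, hM⟩ := iha
    obtain ⟨N, hN⟩ := ihb
    refine ⟨M + N, fun g => ?_⟩
    have := (SimpleGraph.mulCayley S).edist_triangle (u := g) (v := g * a) (w := g * a * b)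
    rw [← mul_assoc]
    refine this.trans ?_
    push_cast
    exact add_le_add (hM g) (hN (g * a))
  | inv a _ ih =>
    obtain ⟨N, hN⟩ := ih
    refine ⟨N, fun g => ?_⟩
    have := hN (g * a⁻¹)
    rw [inv_mul_cancel_right] at this
    rw [ball, Set.mem_ofPred_eq] at this ⊢
    rwa [SimpleGraph.edist_comm]

theorem ball_mono {R R' : ℕ} (h : R ≤ R') (g : G) : ball S R g ⊆ ball S R' g :=
  fun _ hx => le_trans (b := (R : ℕ∞)) hx (by exact_mod_cast h)

theorem eq_univ_of_adj_mem (hSG : Subgroup.closure S = ⊤) {T : Set G} (hT : T.Nonempty)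
    (h : ∀ v ∈ T, ∀ w, (SimpleGraph.mulCayley S).Adj v w → w ∈ T) : T = Set.univ := by
  obtain ⟨v, hv⟩ := hT
  refine Set.eq_univ_of_forall fun w => ?_
  obtain ⟨N, hN⟩ := exists_mul_mem_ball hSG (v⁻¹ * w)
  have := hN v
  rw [mul_inv_cancel_left] at this
  obtain ⟨p, -⟩ := exists_walk_of_mem_ball this
  clear this hN
  induction p with
  | nil => exact hv
  | cons hadj q ih => exact ih (h _ hv _ hadj)

/-- An edge leaving `Y \ Z` would start at a boundary point of `Z` in `Y` or at a boundary point of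
`Y` outside `Z`. Hence `Y \ Z` is empty or, by connectedness of the Cayley graph, everything. -/
theorem subset_of_boundary (hSG : Subgroup.closure S = ⊤) {Y Z : Set G} (hY : Y ≠ Set.univ)
    (hZY : ∀ v ∈ boundary S Z, v ∉ Y) (hYZ : boundary S Y ⊆ Z) : Y ⊆ Z := by
  by_contra hcon
  obtain ⟨y, hy, hyZ⟩ := Set.not_subset.mp hcon
  refine hY (Set.eq_univ_of_univ_subset ?_)
  rw [← eq_univ_of_adj_mem hSG (T := Y \ Z) ⟨y, hy, hyZ⟩ ?_]
  · exact Set.sdiff_subset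
  · rintro v ⟨hv, hvZ⟩ w hvw
    have h1 := mem_iff_of_notMem_boundary (fun h => hZY v h hv) hvw
    have h2 := mem_iff_of_notMem_boundary (fun h => hvZ (hYZ h)) hvw
    exact ⟨h2.mp hv, fun h => hvZ (h1.mpr h)⟩

/-- Two sets whose boundaries lie on one side of each other have an empty corner. -/
theorem exists_corner_eq_empty (hSG : Subgroup.closure S = ⊤) {A B : Set G}
    (hB : B ≠ Set.univ) (hB' : Bᶜ ≠ Set.univ)
    (hAB : boundary S A ⊆ B ∨ boundary S A ⊆ Bᶜ) (hBA : boundary S B ⊆ A ∨ boundary S B ⊆ Aᶜ) :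
    ∃ r, corner A B r = ∅ := by
  rcases hAB with hAB | hAB <;> rcases hBA with hBA | hBA
  · have := subset_of_boundary hSG (Y := Bᶜ) (Z := A) hB' (fun v hv h => h (hAB hv)) (by simpa)
    exact ⟨(false, false), (Set.disjoint_compl_left_iff_subset.mpr this).inter_eq⟩
  · have := subset_of_boundary hSG (Y := Bᶜ) (Z := Aᶜ) hB'
      (fun v hv h => h (hAB (by simpa using hv))) (by simpa)
    exact ⟨(true, false),
      (Set.disjoint_compl_right_iff_subset.mpr (Set.compl_subset_compl.mp this)).inter_eq⟩
  · have := subset_of_boundary hSG (Y := B) (Z := A) hB (fun v hv h => hAB hv h) hBA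
    exact ⟨(false, true), (Set.disjoint_compl_left_iff_subset.mpr this).inter_eq⟩
  · have := subset_of_boundary hSG (Y := B) (Z := Aᶜ) hB
      (fun v hv h => hAB (by simpa using hv) h) hBA
    exact ⟨(true, true), (Set.subset_compl_iff_disjoint_left.mp this).inter_eq⟩

/-- An empty corner is small, so if it is not already known to be `U ∩ Vᶜ`, uniqueness of the small
corner makes it so. -/
theorem AlmostLE.subset_of_corner_eq_empty {U V : Set G} (hU : IsNontrivial U)
    (h : AlmostLE U V) {r : Bool × Bool} (hr : corner U V r = ∅) : U ⊆ V := by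
  have hsub : corner U V (true, false) = ∅ → U ⊆ V := fun h =>
    Set.disjoint_compl_right_iff_subset.mp (Set.disjoint_iff_inter_eq_empty.mpr h)
  rcases h with h | h
  · exact hsub h
  · have hs : IsSmallCorner U V r := by
      refine isSmallInter_of_eq_empty ?_ hr
      rcases r with ⟨_ | _, _⟩
      · exact hU.compl
      · exact hU
    rw [(h r).mp hs] at hr
    exact hsub hr

/-- If the boundary of `Y` avoids suitable finitely many points near `g`, then `g` and `g * t` lie
on the same side of `Y`. -/
theorem exists_finite_forall_mem_iff (hSG : Subgroup.closure S = ⊤) (t : G) :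
    ∃ D : Set G, D.Finite ∧ ∀ (Y : Set G) (g : G), (∀ d ∈ D, g * d ∉ boundary S Y) →
      (g ∈ Y ↔ g * t ∈ Y) := by
  have ht : t ∈ Subgroup.closure S := hSG ▸ Subgroup.mem_top t
  induction ht using Subgroup.closure_induction with
  | mem s hs =>
    refine ⟨{1}, Set.finite_singleton _, fun Y g h => ?_⟩
    by_cases hgs : g = g * s
    · rw [← hgs]
    · refine mem_iff_of_notMem_boundary (by simpa using h 1 rfl)
        ((SimpleGraph.mulCayley_adj' S _ _).mpr ⟨hgs, s, hs, Or.inl rfl⟩)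
  | one => exact ⟨∅, Set.finite_empty, fun Y g _ => by rw [mul_one]⟩
  | mul a b _ _ iha ihb =>
    obtain ⟨D, hD, h⟩ := iha
    obtain ⟨D', hD', h'⟩ := ihb
    refine ⟨D ∪ a • D', hD.union hD'.smul_set, fun Y g hg => ?_⟩
    rw [h Y g fun d hd => hg d (Or.inl hd), h' Y (g * a) fun d hd => ?_, mul_assoc]
    rw [mul_assoc]
    exact hg _ (Or.inr ⟨d, hd, rfl⟩)
  | inv a _ ih =>
    obtain ⟨D, hD, h⟩ := ih
    refine ⟨a⁻¹ • D, hD.smul_set, fun Y g hg => ?_⟩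
    rw [h Y (g * a⁻¹) fun d hd => ?_, inv_mul_cancel_right]
    rw [mul_assoc]
    exact hg _ ⟨d, hd, rfl⟩

/-- For a finitely generated subgroup `H`, a set `Y` whose boundary is far from `H` has each
`H`-finite set on one side. -/
theorem exists_finite_subset_or_subset_compl (hSG : Subgroup.closure S = ⊤) {H : Subgroup G}
    (hH : H.FG) {Z : Set G} (hZ : IsHFinite H Z) :
    ∃ D : Set G, D.Finite ∧ ∀ Y : Set G, (∀ h ∈ H, ∀ d ∈ D, h * d ∉ boundary S Y) →
      Z ⊆ Y ∨ Z ⊆ Yᶜ := by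
  obtain ⟨T, hT⟩ := hH
  obtain ⟨F, hF, hZF⟩ := hZ
  choose D hD hDY using fun t : G => exists_finite_forall_mem_iff hSG t
  refine ⟨⋃ t ∈ (T : Set G) ∪ F, D t, (T.finite_toSet.union hF).biUnion fun t _ => hD t,
    fun Y hY => ?_⟩
  have hstep : ∀ h ∈ H, ∀ t ∈ (T : Set G) ∪ F, (h ∈ Y ↔ h * t ∈ Y) := fun h hh t ht =>
    hDY t Y h fun d hd => hY h hh d (Set.mem_biUnion ht hd)
  -- Finite generation of `H` enters here: finitely many path conditions, translated by `H`, connect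
  -- all of `H` without crossing the boundary of `Y`.
  have hHY : ∀ k ∈ H, ∀ h ∈ H, (h ∈ Y ↔ h * k ∈ Y) := by
    intro k hk
    rw [← hT] at hk
    induction hk using Subgroup.closure_induction with
    | mem t ht => exact fun h hh => hstep h hh t (Or.inl ht)
    | one => exact fun h _ => by rw [mul_one]
    | mul a b ha _ iha ihb =>
      intro h hh
      rw [iha h hh, ihb _ (H.mul_mem hh (hT ▸ ha)), mul_assoc]
    | inv a ha ih =>
      intro h hh
      rw [ih (h * a⁻¹) (H.mul_mem hh (H.inv_mem (hT ▸ ha))), inv_mul_cancel_right]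
  have hall : ∀ z ∈ Z, (z ∈ Y ↔ (1 : G) ∈ Y) := by
    intro z hz
    obtain ⟨h, hh, f, hf, rfl⟩ := hZF hz
    have h1 := hHY h hh 1 H.one_mem
    have h2 := hstep h hh f (Or.inr hf)
    rw [one_mul] at h1
    exact (h1.trans h2).symm
  by_cases h1 : (1 : G) ∈ Y
  · exact Or.inl fun z hz => (hall z hz).mpr h1
  · exact Or.inr fun z hz h => h1 ((hall z hz).mp h)

/-- Up to translation there are only finitely many pairs `A, B` in `E` for which the boundary of
`A` is not on one side of `B`. -/
theorem exists_finite_pairs {n : ℕ} {H : Fin n → Subgroup G} (hH : ∀ i, (H i).FG)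
    {X : Fin n → Set G} (hX : ∀ i, IsNontrivialAlmostInvariant (H i) (X i)) (hS : S.Finite)
    (hSG : Subgroup.closure S = ⊤) :
    ∃ Q : Set (Set G × Set G), Q.Finite ∧ ∀ A ∈ translates X, ∀ B ∈ translates X,
      (boundary S A ⊆ B ∨ boundary S A ⊆ Bᶜ) ∨ ∃ m : G, (m • A, m • B) ∈ Q := by
  have hbd := fun i => (hX i).isHFinite_boundary hS
  choose F hF hbF using hbd
  choose D hD hDY using fun i =>
    exists_finite_subset_or_subset_compl hSG (hH i) ((hX i).isHFinite_boundary hS)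
  refine ⟨⋃ i, ⋃ j, ⋃ b, ⋃ b', Set.image2
    (fun f d => ((f * d⁻¹) • side (X i) b, side (X j) b')) (F j) (D i),
    Set.finite_iUnion fun i => Set.finite_iUnion fun j => Set.finite_iUnion fun b =>
      Set.finite_iUnion fun b' => Set.Finite.image2 _ (hF j) (hD i), ?_⟩
  intro A hA B hB
  obtain ⟨i, b, k, rfl⟩ := mem_translates_iff.mp hA
  obtain ⟨j, b', l, rfl⟩ := mem_translates_iff.mp hB
  by_cases hfar : ∀ h ∈ H i, ∀ d ∈ D i, h * d ∉ boundary S ((k⁻¹ * l) • side (X j) b')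
  · refine Or.inl ((hDY i _ hfar).imp (fun h v hv => ?_) (fun h v hv => ?_))
    · rw [mem_boundary_smul_iff, boundary_side] at hv
      have := h hv
      rw [Set.mem_smul_set_iff_inv_smul_mem] at this ⊢
      simpa [mul_assoc] using this
    · rw [mem_boundary_smul_iff, boundary_side] at hv
      have := h hv
      rw [Set.mem_compl_iff, Set.mem_smul_set_iff_inv_smul_mem] at this ⊢
      simpa [mul_assoc] using this
  · push Not at hfar
    obtain ⟨h, hh, d, hd, hmem⟩ := hfar
    rw [mem_boundary_smul_iff, boundary_side] at hmem
    obtain ⟨h', hh', f, hf, heq⟩ := hbF j hmem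
    -- The meeting point gives `h * d = k⁻¹ * l * h' * f`. This translation carries the pair to a
    -- standard one, after `h` and `h'` are absorbed by the stabilisers of `X i` and `X j`.
    refine Or.inr ⟨h'⁻¹ * l⁻¹, ?_⟩
    simp only [Set.mem_iUnion]
    refine ⟨i, j, b, b', f, hf, d, hd, ?_⟩
    have e1 : h'⁻¹ * l⁻¹ * k = f * d⁻¹ * h⁻¹ := by
      simp only at heq
      have : f = h'⁻¹ * ((k⁻¹ * l)⁻¹ * (h * d)) := by rw [← heq, inv_mul_cancel_left]
      rw [this]
      group
    refine Prod.ext ?_ ?_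
    · simp only
      rw [smul_smul, e1, mul_smul _ h⁻¹, ((hX i).side b).smul_eq ((H i).inv_mem hh)]
    · simp only
      rw [smul_smul, inv_mul_cancel_right, ((hX j).side b').smul_eq ((H j).inv_mem hh')]

theorem IsNontrivial.ne_univ {A : Set G} (hA : IsNontrivial A) : A ≠ Set.univ := by
  rintro rfl
  obtain ⟨H, hA⟩ := hA
  exact hA.compl_infinite (by simp)

/-- Fix `a ∉ A`. The points of `A ∩ Bᶜ` have the form `h * f` with finitely many `f`, and right
multiplication by `f⁻¹ * a` leads to `h * a ∉ A`. So each is within bounded distance of `Aᶜ`. -/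
theorem AlmostLE.exists_radius (hSG : Subgroup.closure S = ⊤) {A B : Set G}
    (hA : IsNontrivial A) (hB : IsNontrivial B) (h : AlmostLE A B) :
    ∃ R : ℕ, ∀ g, ball S R g ⊆ A → g ∈ A → g ∈ B := by
  have hs := h.isSmallInter hA hB
  have hne := hA.ne_univ
  obtain ⟨H, hA⟩ := hA
  obtain ⟨F, hF, hFs⟩ := (isSmallInter_iff hA hB.compl).mp hs
  obtain ⟨a, ha⟩ := (Set.ne_univ_iff_exists_notMem A).mp hne
  choose N hN using fun t : G => exists_mul_mem_ball hSG t
  obtain ⟨R, hR⟩ := (hF.image fun f => N (f⁻¹ * a)).bddAbove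
  refine ⟨R, fun g hgA hg => ?_⟩
  by_contra hgB
  obtain ⟨h, hh, f, hf, rfl⟩ := hFs ⟨hg, hgB⟩
  have hmem : h * f * (f⁻¹ * a) ∈ A :=
    hgA (ball_mono (hR ⟨f, hf, rfl⟩) _ (hN (f⁻¹ * a) (h * f)))
  have : h * f * (f⁻¹ * a) = h * a := by group
  rw [this, hA.mul_mem_iff hh] at hmem
  exact ha hmem

theorem exists_isAdmissibleRadius {n : ℕ} {H : Fin n → Subgroup G} (hH : ∀ i, (H i).FG)
    {X : Fin n → Set G} (hX : ∀ i, IsNontrivialAlmostInvariant (H i) (X i)) (hS : S.Finite)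
    (hSG : Subgroup.closure S = ⊤) : ∃ R : ℕ, IsAdmissibleRadius X S R := by
  have hE : ∀ A ∈ translates X, IsNontrivial A := fun A => isNontrivial_of_mem_translates hX
  obtain ⟨Q, hQ, hQE⟩ := exists_finite_pairs hH hX hS hSG
  have hrad : ∀ p : Set G × Set G, ∃ R : ℕ, p.1 ∈ translates X → p.2 ∈ translates X →
      AlmostLE p.1 p.2 → ∀ g, ball S R g ⊆ p.1 → g ∈ p.1 → g ∈ p.2 := by
    intro p
    by_cases hp : p.1 ∈ translates X ∧ p.2 ∈ translates X ∧ AlmostLE p.1 p.2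
    · obtain ⟨R, hR⟩ := hp.2.2.exists_radius hSG (hE _ hp.1) (hE _ hp.2.1)
      exact ⟨R, fun _ _ _ => hR⟩
    · exact ⟨0, fun h1 h2 h3 => absurd ⟨h1, h2, h3⟩ hp⟩
  choose N hN using hrad
  -- Swapped pairs are included because the exceptional pair may be `(B, A)` as well as `(A, B)`.
  -- The radius used below is `R + 1`, to be positive.
  obtain ⟨R, hR⟩ := ((hQ.union (hQ.image Prod.swap)).image N).bddAbove
  refine ⟨R + 1, Nat.succ_pos R, fun A hA B hB hAB g hg hball => ?_⟩
  have hnear : ∀ m : G, (m • A, m • B) ∈ Q ∪ Prod.swap '' Q → g ∈ B := by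
    intro m hm
    have := hN (m • A, m • B) (smul_mem_translates m hA) (smul_mem_translates m hB)
      ((almostLE_smul_iff m A B).mpr hAB) (m * g) ?_ (Set.smul_mem_smul_set hg)
    · simpa [Set.mem_smul_set_iff_inv_smul_mem] using this
    · intro x hx
      have hx' := ball_mono ((hR ⟨_, hm, rfl⟩).trans (Nat.le_succ R)) _ hx
      rw [Set.mem_smul_set_iff_inv_smul_mem]
      have := mem_ball_smul S (R + 1) m⁻¹ _ _ hx'
      rw [inv_mul_cancel_left] at this
      exact hball this
  rcases hQE A hA B hB with h1 | ⟨m, hm⟩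
  · rcases hQE B hB A hA with h2 | ⟨m, hm⟩
    · obtain ⟨r, hr⟩ := exists_corner_eq_empty hSG (hE B hB).ne_univ (hE B hB).compl.ne_univ h1 h2
      exact hAB.subset_of_corner_eq_empty (hE A hA) hr hg
    · exact hnear m (Or.inr ⟨_, hm, rfl⟩)
  · exact hnear m (Or.inl hm)

end Boundary

/-! ### Basic vertices for almost inclusion -/

section BasicVertices

variable {G : Type*} [Group G] {S : Set G} {n : ℕ} {X : Fin n → Set G}

theorem isUltrafilterOn_basicV (X : Fin n → Set G) (g : G) :
    IsUltrafilterOn (translates X) (fun A B => A ⊆ B) (basicV (translates X) g) where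
  subset := fun _ hA => hA.1
  mem_xor A hA := by
    have hA' := compl_mem_translates hA
    simp only [basicV, Set.mem_ofPred_eq, Set.mem_compl_iff]
    tauto
  upward := fun _ hA _ hB hAB => ⟨hB, hAB hA.2⟩

theorem IsUltrafilterOn.of_almostLE {E V : Set (Set G)} (h : IsUltrafilterOn E AlmostLE V) :
    IsUltrafilterOn E (fun A B => A ⊆ B) V :=
  ⟨h.subset, h.mem_xor, fun A hA B hB hAB => h.upward A hA B hB (almostLE_of_subset hAB)⟩

/-- The properties of `U_1` that are preserved by the completion steps. -/
structure IsPartialVertex (X : Fin n → Set G) (S : Set G) (R : ℕ) (g : G) (U : Set (Set G)) :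
    Prop where
  subset : U ⊆ translates X
  upward : ∀ A ∈ U, ∀ B ∈ translates X, AlmostLE A B → B ∈ U
  consistent : ∀ A ∈ U, Aᶜ ∉ U
  initialU_subset : initialU X S R g ⊆ U

theorem initialU_of_almostLE {R : ℕ} (hR : IsAdmissibleRadius X S R) {g : G} {A B : Set G}
    (hA : A ∈ initialU X S R g) (hB : B ∈ translates X) (hAB : AlmostLE A B) : g ∈ B :=
  hR.2 A hA.1.1 B hB hAB g hA.2 (ball_subset_of_notMem_nearSets hA.1.1 hA.1.2 hA.2)

theorem isPartialVertex_firstU (hE : ∀ A ∈ translates X, IsNontrivial A) {R : ℕ}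
    (hR : IsAdmissibleRadius X S R) (g : G) :
    IsPartialVertex X S R g (firstU X S R g) := by
  have hsub : firstU X S R g ⊆ translates X := by
    rintro A (hA | hA)
    · exact hA.1.1
    · exact hA.1.1
  have hbelow : ∀ B ∈ firstU X S R g, ∃ A ∈ initialU X S R g, AlmostLE A B := by
    rintro B (hB | hB)
    · exact ⟨B, hB, almostLE_of_subset subset_rfl⟩
    · exact hB.2
  refine ⟨hsub, ?_, ?_, Set.subset_union_left⟩
  · intro A hA B hB hAB
    obtain ⟨A₀, hA₀, hle⟩ := hbelow A hA
    have hle' := hle.trans (hE _ hA₀.1.1) (hE _ (hsub hA)) (hE _ hB) hAB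
    by_cases hBn : B ∈ nearSets X S R g
    · exact Or.inr ⟨hBn, A₀, hA₀, hle'⟩
    · exact Or.inl ⟨⟨hB, hBn⟩, initialU_of_almostLE hR hA₀ hB hle'⟩
  · intro A hA hAc
    obtain ⟨A₀, hA₀, hle⟩ := hbelow A hA
    obtain ⟨A₁, hA₁, hle₁⟩ := hbelow Aᶜ hAc
    have nA := hE _ (hsub hA)
    have n₁ := hE _ hA₁.1.1
    have hle₂ := hle₁.compl n₁ nA.compl
    rw [compl_compl] at hle₂
    -- If `A` and `Aᶜ` lie above `A₀` and `A₁` in `U_g`, then `A₀ ≤ A₁ᶜ`. Admissibility puts `g`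
    -- into `A₁ᶜ`, although `g ∈ A₁`.
    exact initialU_of_almostLE hR hA₀ (compl_mem_translates hA₁.1.1)
      (hle.trans (hE _ hA₀.1.1) nA n₁.compl hle₂) hA₁.2

theorem IsPartialVertex.step (hE : ∀ A ∈ translates X, IsNontrivial A) {R : ℕ} {g : G}
    {U U' : Set (Set G)} (hU : IsPartialVertex X S R g U)
    (h : CompletionStep (translates X) AlmostLE U U') : IsPartialVertex X S R g U' := by
  obtain ⟨A, hA, -, rfl⟩ := h
  have nA := hE A hA.1
  have hmem : ∀ B, B ∈ U ∪ {A} ∪ {B ∈ undecided (translates X) U | AlmostLE A B} ↔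
      B ∈ U ∨ B ∈ undecided (translates X) U ∧ AlmostLE A B := by
    intro B
    simp only [Set.mem_union, Set.mem_singleton_iff, Set.mem_ofPred_eq]
    constructor
    · rintro ((hB | rfl) | hB)
      · exact Or.inl hB
      · exact Or.inr ⟨hA, almostLE_of_subset subset_rfl⟩
      · exact Or.inr hB
    · rintro (hB | hB)
      · exact Or.inl (Or.inl hB)
      · exact Or.inr hB
  refine ⟨?_, ?_, ?_, ?_⟩
  · intro B hB
    rcases (hmem B).mp hB with hB | hB
    · exact hU.subset hB
    · exact hB.1.1
  · intro B hB C hC hBC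
    rw [hmem] at hB ⊢
    rcases hB with hB | ⟨hB, hAB⟩
    · exact Or.inl (hU.upward B hB C hC hBC)
    · have hAC := hAB.trans nA (hE B hB.1) (hE C hC) hBC
      by_cases hCU : C ∈ U
      · exact Or.inl hCU
      · refine Or.inr ⟨⟨hC, hCU, fun hCc => ?_⟩, hAC⟩
        -- If `Cᶜ` were already chosen, so would be `Aᶜ` above it, but `A` is undecided.
        exact hA.2.2 (hU.upward _ hCc _ (compl_mem_translates hA.1) (hAC.compl nA (hE C hC)))
  · intro B hB hBc
    rw [hmem] at hB hBc
    rcases hB with hB | ⟨hB, hAB⟩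
    · rcases hBc with hBc | ⟨hBc, -⟩
      · exact hU.consistent B hB hBc
      · exact hBc.2.2 (by rwa [compl_compl])
    · rcases hBc with hBc | ⟨-, hABc⟩
      · exact hB.2.2 hBc
      -- Adding both `B` and `Bᶜ` would mean `A ≤ B ≤ Aᶜ`.
      · have nB := hE B hB.1
        have := hABc.compl nA nB.compl
        rw [compl_compl] at this
        exact not_almostLE_compl nA (hAB.trans nA nB nA.compl this)
  · exact fun B hB => (hmem B).mpr (Or.inl (hU.initialU_subset hB))

theorem IsPartialVertex.of_reflTransGen (hE : ∀ A ∈ translates X, IsNontrivial A) {R : ℕ} {g : G}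
    {U U' : Set (Set G)} (hU : IsPartialVertex X S R g U)
    (h : Relation.ReflTransGen (CompletionStep (translates X) AlmostLE) U U') :
    IsPartialVertex X S R g U' := by
  induction h with
  | refl => exact hU
  | tail _ hs ih => exact ih.step hE hs

theorem IsPartialVertex.mem_nearSets {R : ℕ} {g : G} {U : Set (Set G)}
    (hU : IsPartialVertex X S R g U) {A : Set G} (hA : A ∈ translates X) (hAU : A ∉ U)
    (hg : g ∈ A) : A ∈ nearSets X S R g := by
  by_contra hn
  exact hAU (hU.initialU_subset ⟨⟨hA, hn⟩, hg⟩)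

theorem IsPartialVertex.undecided_subset {R : ℕ} {g : G} {U : Set (Set G)}
    (hU : IsPartialVertex X S R g U) : undecided (translates X) U ⊆ nearSets X S R g := by
  rintro A ⟨hA, hAU, hAcU⟩
  by_cases hg : g ∈ A
  · exact hU.mem_nearSets hA hAU hg
  · exact compl_mem_nearSets_iff.mp (hU.mem_nearSets (compl_mem_translates hA) hAcU hg)

/-- Undecided elements always lie in the finite set `E_R`, so a minimal one exists while any remain,
and each step strictly reduces their number. -/
theorem IsPartialVertex.exists_completion (hE : ∀ A ∈ translates X, IsNontrivial A) {R : ℕ}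
    {g : G} (hfin : (nearSets X S R g).Finite) {U : Set (Set G)}
    (hU : IsPartialVertex X S R g U) :
    ∃ W, Relation.ReflTransGen (CompletionStep (translates X) AlmostLE) U W ∧
      undecided (translates X) W = ∅ := by
  induction hN : (undecided (translates X) U).ncard using Nat.strong_induction_on
    generalizing U with
  | _ N ih =>
    rcases (undecided (translates X) U).eq_empty_or_nonempty with he | hne
    · exact ⟨U, .refl, he⟩
    · have hufin := hfin.subset hU.undecided_subset
      obtain ⟨A, hA, hmin⟩ := exists_minimal_of_finite (r := AlmostLE) hufin hne
        (fun a ha b hb c hc h h' => h.trans (hE a ha.1) (hE b hb.1) (hE c hc.1) h')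
        (fun a ha b hb h h' => h.antisymm (hE a ha.1) (hE b hb.1) h')
      have hstep : CompletionStep (translates X) AlmostLE U _ := ⟨A, hA, hmin, rfl⟩
      have hlt : undecided (translates X)
          (U ∪ {A} ∪ {B ∈ undecided (translates X) U | AlmostLE A B})
          ⊂ undecided (translates X) U := by
        refine ⟨fun B hB => ⟨hB.1, fun h => hB.2.1 (.inl (.inl h)),
          fun h => hB.2.2 (.inl (.inl h))⟩, fun h => (h hA).2.1 (.inl (.inr rfl))⟩
      obtain ⟨W, hW, hW'⟩ := ih _ (hN ▸ Set.ncard_lt_ncard hlt hufin) (hU.step hE hstep) rfl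
      exact ⟨W, .head hstep hW, hW'⟩

theorem IsPartialVertex.isUltrafilterOn {R : ℕ} {g : G} {W : Set (Set G)}
    (hW : IsPartialVertex X S R g W) (hun : undecided (translates X) W = ∅) :
    IsUltrafilterOn (translates X) AlmostLE W where
  subset := hW.subset
  mem_xor A hA := by
    refine ⟨?_, fun h => hW.consistent A h.1 h.2⟩
    by_contra! hcon
    exact Set.notMem_empty A (hun ▸ ⟨hA, hcon⟩)
  upward := hW.upward

theorem IsPartialVertex.symmDiff_basicV_subset {R : ℕ} {g : G} {W : Set (Set G)}
    (hW : IsPartialVertex X S R g W) :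
    W ∆ basicV (translates X) g ⊆ nearSets X S R g := by
  rintro A (⟨hAW, hAV⟩ | ⟨hAV, hAW⟩)
  · have hA := hW.subset hAW
    refine compl_mem_nearSets_iff.mp (hW.mem_nearSets (compl_mem_translates hA)
      (hW.consistent A hAW) fun hg => hAV ⟨hA, hg⟩)
  · exact hW.mem_nearSets hAV.1 hAW hAV.2

variable {H : Fin n → Subgroup G}

theorem finite_basicV_sdiff (hX : ∀ i, IsNontrivialAlmostInvariant (H i) (X i)) (g h : G) :
    (basicV (translates X) g \ basicV (translates X) h).Finite :=
  (finite_separating hX g h).subset fun _ hA => ⟨hA.1.1, hA.1.2, fun h' => hA.2 ⟨hA.1.1, h'⟩⟩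

theorem IsBasicW.isPartialVertex (hE : ∀ A ∈ translates X, IsNontrivial A) {R : ℕ}
    (hR : IsAdmissibleRadius X S R) {g : G} {W : Set (Set G)} (hW : IsBasicW X S R g W) :
    IsPartialVertex X S R g W :=
  (isPartialVertex_firstU hE hR g).of_reflTransGen hE hW.1

theorem IsBasicW.isUltrafilterOn (hE : ∀ A ∈ translates X, IsNontrivial A) {R : ℕ}
    (hR : IsAdmissibleRadius X S R) {g : G} {W : Set (Set G)} (hW : IsBasicW X S R g W) :
    IsUltrafilterOn (translates X) AlmostLE W :=
  (hW.isPartialVertex hE hR).isUltrafilterOn hW.2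

theorem IsBasicW.finite_symmDiff (hX : ∀ i, IsNontrivialAlmostInvariant (H i) (X i))
    (hS : S.Finite) {R : ℕ} (hR : IsAdmissibleRadius X S R) {g : G} {W : Set (Set G)}
    (hW : IsBasicW X S R g W) : (W ∆ basicV (translates X) g).Finite :=
  (finite_nearSets hX hS R g).subset
    (hW.isPartialVertex (fun _ => isNontrivial_of_mem_translates hX) hR).symmDiff_basicV_subset

theorem exists_isBasicW (hX : ∀ i, IsNontrivialAlmostInvariant (H i) (X i)) (hS : S.Finite)
    {R : ℕ} (hR : IsAdmissibleRadius X S R) (g : G) : ∃ W, IsBasicW X S R g W :=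
  have hE : ∀ A ∈ translates X, IsNontrivial A := fun _ => isNontrivial_of_mem_translates hX
  (isPartialVertex_firstU hE hR g).exists_completion hE (finite_nearSets hX hS R g)

/-! ### The components `C` and `L` and the inclusion between them -/

theorem isPocset_cubingC (X : Fin n → Set G) : (cubingC X).IsPocset where
  compl_mem := fun _ => compl_mem_translates
  antisymm := fun _ _ _ _ h h' => Set.Subset.antisymm h h'
  trans := fun _ _ _ _ _ _ h h' => Set.Subset.trans h h'
  compl := fun _ _ _ _ h => Set.compl_subset_compl.mpr h

theorem isPocset_cubingL (hE : ∀ A ∈ translates X, IsNontrivial A) (S : Set G) (R : ℕ) :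
    (cubingL X S R).IsPocset where
  compl_mem := fun _ => compl_mem_translates
  antisymm := fun A hA B hB h h' => AlmostLE.antisymm (hE A hA) (hE B hB) h h'
  trans := fun A hA B hB C hC h h' => AlmostLE.trans (hE A hA) (hE B hB) (hE C hC) h h'
  compl := fun A hA B hB h => AlmostLE.compl (hE A hA) (hE B hB) h

theorem cubingC_connected (hX : ∀ i, IsNontrivialAlmostInvariant (H i) (X i)) :
    (cubingC X).graph.Connected := by
  refine CubingData.graph_connected ⟨⟨_, isUltrafilterOn_basicV X 1⟩, 1, rfl⟩ ?_
  rintro W W' ⟨g, hg⟩ ⟨h, hh⟩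
  refine (isPocset_cubingC X).reachable W W' ?_
  rw [← hg, ← hh]
  exact finite_basicV_sdiff hX g h

theorem cubingL_connected (hX : ∀ i, IsNontrivialAlmostInvariant (H i) (X i)) (hS : S.Finite)
    {R : ℕ} (hR : IsAdmissibleRadius X S R) : (cubingL X S R).graph.Connected := by
  have hE : ∀ A ∈ translates X, IsNontrivial A := fun _ => isNontrivial_of_mem_translates hX
  obtain ⟨W₀, hW₀⟩ := exists_isBasicW hX hS hR 1
  refine CubingData.graph_connected ⟨⟨W₀, hW₀.isUltrafilterOn hE hR⟩, 1, hW₀⟩ ?_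
  rintro W W' ⟨g, hg⟩ ⟨h, hh⟩
  refine (isPocset_cubingL hE S R).reachable W W' ?_
  -- Compares `W` with `W'` through `V_g` and `V_h`; each of the three differences is finite.
  refine (((hg.finite_symmDiff hX hS hR).union (finite_basicV_sdiff hX g h)).union
    (hh.finite_symmDiff hX hS hR)).subset ?_
  rintro A ⟨hA, hA'⟩
  by_cases h1 : A ∈ basicV (translates X) g
  · by_cases h2 : A ∈ basicV (translates X) h
    · exact Or.inr (Or.inr ⟨h2, hA'⟩)
    · exact Or.inl (Or.inr ⟨h1, h2⟩)
  · exact Or.inl (Or.inl (Or.inl ⟨hA, h1⟩))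

/-- Ultrafilters for almost inclusion are ultrafilters for inclusion, with the same edges. -/
def ultraInclusion (X : Fin n → Set G) (S : Set G) (R : ℕ) :
    (cubingL X S R).fullGraph ↪g (cubingC X).fullGraph where
  toFun V := ⟨V.1, V.2.of_almostLE⟩
  inj' := fun _ _ h => Subtype.ext (congrArg (fun W : (cubingC X).Ultra => W.1) h)
  map_rel_iff' := Iff.rfl

theorem exists_reachable_ultraInclusion (hX : ∀ i, IsNontrivialAlmostInvariant (H i) (X i))
    (hS : S.Finite) {R : ℕ} (hR : IsAdmissibleRadius X S R) (V : (cubingL X S R).Vertex) :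
    ∃ W : (cubingC X).Ultra, W.1 ∈ (cubingC X).basic ∧
      (cubingC X).fullGraph.Reachable W (ultraInclusion X S R V.1) := by
  obtain ⟨W, ⟨g, hW⟩, hWV⟩ := V.2
  refine ⟨⟨_, isUltrafilterOn_basicV X g⟩, ⟨g, rfl⟩, ?_⟩
  refine .trans ?_ (hWV.map (ultraInclusion X S R).toHom)
  refine (isPocset_cubingC X).reachable _ _ ?_
  exact (hW.finite_symmDiff hX hS hR).subset fun A hA => Or.inr hA

/-- The inclusion of the vertices of the cubing for almost inclusion in those of the cubing for
inclusion. -/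
def vertexInclusion (hX : ∀ i, IsNontrivialAlmostInvariant (H i) (X i)) (hS : S.Finite) {R : ℕ}
    (hR : IsAdmissibleRadius X S R) : (cubingL X S R).graph ↪g (cubingC X).graph where
  toFun V := ⟨ultraInclusion X S R V.1, exists_reachable_ultraInclusion hX hS hR V⟩
  inj' := fun _ _ h =>
    Subtype.ext ((ultraInclusion X S R).injective (congrArg Subtype.val h))
  map_rel_iff' := Iff.rfl

/-- The map of cube complexes induced by the inclusion of the vertices. -/
def complexInclusion (hX : ∀ i, IsNontrivialAlmostInvariant (H i) (X i)) (hS : S.Finite) {R : ℕ}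
    (hR : IsAdmissibleRadius X S R) : (cubingL X S R).Complex → (cubingC X).Complex :=
  Realization.map (vertexInclusion hX hS hR).toCopy

/-- Both composites are induced by the same map of vertices, because translation and inclusion act
on the underlying sets. -/
theorem complexInclusion_smul (hX : ∀ i, IsNontrivialAlmostInvariant (H i) (X i))
    (hS : S.Finite) {R : ℕ} (hR : IsAdmissibleRadius X S R) (g : G)
    (x : (cubingL X S R).Complex) :
    complexInclusion hX hS hR (g • x) = g • complexInclusion hX hS hR x := by
  refine (Realization.map_map ((cubingL X S R).act g) (vertexInclusion hX hS hR).toCopy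
    ((vertexInclusion hX hS hR).toCopy.comp ((cubingL X S R).act g)) (fun _ => rfl) x).trans ?_
  exact (Realization.map_map (vertexInclusion hX hS hR).toCopy ((cubingC X).act g)
    ((vertexInclusion hX hS hR).toCopy.comp ((cubingL X S R).act g)) (fun _ => rfl) x).symm

end BasicVertices

end MinimalCubing

open MinimalCubing in
theorem mainTheorem1 {G : Type*} [Group G] [Group.FG G] {n : ℕ}
    (H : Fin n → Subgroup G) (hH : ∀ i, (H i).FG)
    (X : Fin n → Set G) (hX : ∀ i, IsNontrivialAlmostInvariant (H i) (X i))
    (hgood : GoodPosition X)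
    (S : Set G) (hS : S.Finite) (hSG : Subgroup.closure S = ⊤) :
    -- almost inclusion is a partial order on `E`, reversed by complementation
    ((∀ A ∈ translates X, AlmostLE A A) ∧
      (∀ A ∈ translates X, ∀ B ∈ translates X, AlmostLE A B → AlmostLE B A → A = B) ∧
      (∀ A ∈ translates X, ∀ B ∈ translates X, ∀ D ∈ translates X,
        AlmostLE A B → AlmostLE B D → AlmostLE A D) ∧
      (∀ A ∈ translates X, ∀ B ∈ translates X, AlmostLE A B → AlmostLE Bᶜ Aᶜ)) ∧
    -- every ultrafilter for almost inclusion is an ultrafilter for inclusion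
    (∀ V : Set (Set G), IsUltrafilterOn (translates X) AlmostLE V →
      IsUltrafilterOn (translates X) (fun A B => A ⊆ B) V) ∧
    -- `C` is a single component containing all `V_g`
    (∀ g : G, IsUltrafilterOn (translates X) (fun A B => A ⊆ B) (basicV (translates X) g)) ∧
    (cubingC X).graph.Connected ∧
    -- the construction of `L` can be carried out
    (∃ R : ℕ, IsAdmissibleRadius X S R) ∧
    ∀ R : ℕ, IsAdmissibleRadius X S R →
      -- basic vertices `W_g` exist, and differ from `V_g` in finitely many places
      (∀ g : G, ∃ W, IsBasicW X S R g W) ∧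
      (∀ (g : G) (W : Set (Set G)), IsBasicW X S R g W →
        IsUltrafilterOn (translates X) AlmostLE W ∧
          (symmDiff W (basicV (translates X) g)).Finite) ∧
      -- `L` is a single component containing all `W_g`
      (cubingL X S R).graph.Connected ∧
      -- the inclusion of the vertices induces a `G`-equivariant embedding of `L` in `C`
      ∃ f : (cubingL X S R).graph ↪g (cubingC X).graph,
        (∀ W : (cubingL X S R).Vertex, (f W).1.1 = W.1.1) ∧
        ∃ F : (cubingL X S R).Complex → (cubingC X).Complex,
          F = Realization.map f.toCopy ∧
          Topology.IsEmbedding F ∧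
          ∀ (g : G) (x : (cubingL X S R).Complex), F (g • x) = g • F x := by
  have hE : ∀ A ∈ translates X, IsNontrivial A := fun _ => isNontrivial_of_mem_translates hX
  refine ⟨⟨fun A _ => almostLE_of_subset subset_rfl,
      fun A hA B hB h h' => h.antisymm (hE A hA) (hE B hB) h',
      fun A hA B hB D hD h h' => h.trans (hE A hA) (hE B hB) (hE D hD) h',
      fun A hA B hB h => h.compl (hE A hA) (hE B hB)⟩,
    fun V hV => hV.of_almostLE, isUltrafilterOn_basicV X, cubingC_connected hX,
    exists_isAdmissibleRadius hH hX hS hSG, fun R hR => ?_⟩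
  exact ⟨exists_isBasicW hX hS hR,
    fun g W hW => ⟨hW.isUltrafilterOn hE hR, hW.finite_symmDiff hX hS hR⟩,
    cubingL_connected hX hS hR, vertexInclusion hX hS hR, fun _ => rfl,
    complexInclusion hX hS hR, rfl, (Realization.isClosedEmbedding_map _).isEmbedding,
    complexInclusion_smul hX hS hR⟩
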